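/- Let $N\ge 1$ and let $K:\mathbb{R}^N\setminus\{0\}\to\mathbb{R}$ be twice continuously differentiable with $|\nabla^j K(x)|\le A\,|x|^{-(N-1+j)}$ for $j=0,1,2$, all $x\ne 0$ and some constant $A$. Then there are positive constants $C$ and $C'$, depending only on $N$ and $K$, such that for every finite (signed) Radon measure $\mu$ on $\mathbb{R}^N$, with total variation measure $|\mu|$ and $\|\mu\|=|\mu|(\mathbb{R}^N)$, the following holds. The potential $(K\star\mu)(x)=\int K(x-w)\,d\mu(w)$ is given by an absolutely convergent integral for almost all $x$, and there is a measurable function $I:\mathbb{R}^N\to[0,\infty)$ with $$|(K\star\mu)(x)-(K\star\mu)(y)|\le |x-y|\,(I(x)+I(y))\qquad\text{for almost all } x,y$$ (that is, for all $x,y$ outside a Lebesgue null set) and $$\sup_{t>0}\,t\,|\{x: I(x)>t\}|\le C\,\|\mu\|.$$ Moreover, both of these inequalities hold for the measurable (possibly somewhere infinite) function $I=C'\,(M(\mu)+T^*(\mu))$, where $$M(\mu)(x)=\sup_{r>0}\frac{|\mu|(B(x,r))}{|B(x,r)|},\qquad T^*(\mu)(x)=\sup_{\varepsilon>0}\Big|\int_{|x-y|>\varepsilon}\nabla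 K(x-y)\,d\mu(y)\Big|.$$ -/

import Mathlib

open MeasureTheory
open scoped ENNReal NNReal

/-- The standing assumption on the kernel: `K` is twice continuously differentiable off the origin
of `ℝ^N` and `|∇ʲ K(x)| ≤ A / |x|^(N-1+j)` for `j = 0, 1, 2` and `x ≠ 0`.
(It is used only for `N ≥ 1`. The value of `K` at the origin is irrelevant.) -/
def IsPotentialKernel {N : ℕ} (K : EuclideanSpace ℝ (Fin N) → ℝ) : Prop :=
  ContDiffOn ℝ 2 K {0}ᶜ ∧
    ∃ A : ℝ, ∀ j : ℕ, j ≤ 2 → ∀ x : EuclideanSpace ℝ (Fin N), x ≠ 0 →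
      ‖iteratedFDeriv ℝ j K x‖ ≤ A / ‖x‖ ^ (N - 1 + j)

/-- The potential `(K ⋆ μ)(x) = ∫ K(x - w) dμ(w)` of a finite signed Radon measure. -/
noncomputable def potential {N : ℕ} (K : EuclideanSpace ℝ (Fin N) → ℝ)
    (μ : SignedMeasure (EuclideanSpace ℝ (Fin N))) (x : EuclideanSpace ℝ (Fin N)) : ℝ :=
  ∫ᵛ w, K (x - w) ∂<•μ

/-- The Hardy–Littlewood maximal function `M(μ)(x) = sup_{r > 0} |μ|(B(x, r)) / |B(x, r)|`,
where `|μ|` is the total variation measure of `μ`. -/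
noncomputable def maximalFunction {N : ℕ} (μ : SignedMeasure (EuclideanSpace ℝ (Fin N)))
    (x : EuclideanSpace ℝ (Fin N)) : ℝ≥0∞ :=
  ⨆ (r : ℝ) (_ : 0 < r), μ.variation (Metric.ball x r) / volume (Metric.ball x r)

/-- The truncated singular integral `∫_{|x - y| > ε} ∇K(x - y) dμ(y)`, a vector of `ℝ^N`. -/
noncomputable def truncatedSingularIntegral {N : ℕ} (K : EuclideanSpace ℝ (Fin N) → ℝ)
    (μ : SignedMeasure (EuclideanSpace ℝ (Fin N))) (ε : ℝ) (x : EuclideanSpace ℝ (Fin N)) :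
    EuclideanSpace ℝ (Fin N) :=
  ∫ᵛ y in {y | ε < ‖x - y‖}, gradient K (x - y) ∂<•μ

/-- The maximal singular integral with kernel `∇K`,
`T*(μ)(x) = sup_{ε > 0} |∫_{|x - y| > ε} ∇K(x - y) dμ(y)|`. -/
noncomputable def maximalSingularIntegral {N : ℕ} (K : EuclideanSpace ℝ (Fin N) → ℝ)
    (μ : SignedMeasure (EuclideanSpace ℝ (Fin N))) (x : EuclideanSpace ℝ (Fin N)) : ℝ≥0∞ :=
  ⨆ (ε : ℝ) (_ : 0 < ε), ‖truncatedSingularIntegral K μ ε x‖ₑ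

/-- The weak `L¹` quasi-norm `sup_{t > 0} t |{x : I(x) > t}|` of a non-negative function. -/
noncomputable def weakL1Norm {N : ℕ} (I : EuclideanSpace ℝ (Fin N) → ℝ≥0∞) : ℝ≥0∞ :=
  ⨆ (t : ℝ≥0) (_ : 0 < t), (t : ℝ≥0∞) * volume {x | (t : ℝ≥0∞) < I x}

/-- `|u(x) - u(y)| ≤ |x - y| (I(x) + I(y))` for all `x`, `y` outside a Lebesgue null set. -/
def PointwiseLipschitz {N : ℕ} (u : EuclideanSpace ℝ (Fin N) → ℝ)
    (I : EuclideanSpace ℝ (Fin N) → ℝ≥0∞) : Prop :=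
  ∃ Z : Set (EuclideanSpace ℝ (Fin N)), volume Z = 0 ∧
    ∀ x, x ∉ Z → ∀ y, y ∉ Z → ‖u x - u y‖ₑ ≤ ‖x - y‖ₑ * (I x + I y)

/-! Put r = |x - y|. Where |x - w| ≤ 2r, the terms K(x - w) and K(y - w) are integrated separately
against |μ|: a singularity of order 1 - N over a ball of radius comparable to r costs at most a
multiple of r M(μ), at x or at y. Where |x - w| > 2r, the difference K(x - w) - K(y - w) equals ⟨x -
y, ∇K(x - w)⟩ up to a Taylor remainder O(r² |x - w|^(-N-1)), whose integral is again O(r M(μ)(x)),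
while the linear term integrates to at most r T*(μ)(x). This is
`enorm_signedIntegral_kernel_sub_le`; it gives the pointwise inequality wherever M(μ) is finite.

The main work is the weak L¹ bound for M(μ) + T*(μ). For M(μ) it is a Vitali covering argument
(`mul_volume_maximalLevelSet_le`). For T*(μ) it is Calderón–Zygmund theory, carried out for measures
and for smooth cutoffs of the kernel, whose constants are uniform in the scale
(`exists_hasKernelBound_cutoff`).

The L² bound comes from a bounded Fourier transform (`exists_norm_fourier_fderiv_le`). No separate
cancellation hypothesis is needed, because ∇K is the derivative of a kernel of order 1 - N. A
Cotlar-type argument passes from L² to the maximal operator on measures of bounded density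
(`exists_mul_volume_cutoff_le_of_le_smul_volume`). The decomposition
`exists_calderonZygmund_decomposition` then reaches all finite measures. Finally the sharp
truncations differ from the smooth ones by O(M(μ)), and signed measures are treated through their
Jordan decomposition (`exists_mul_volume_maximal_le`). -/

section

open Metric Set Filter Topology Module

/-! ### Integrals of power-type kernels against measures of d-dimensional growth -/

section Growth

lemma setLIntegral_enorm_le_of_norm_le {α : Type*} [MeasurableSpace α] {ν : Measure α} {F : Type*} [NormedAddCommGroup F]
    {f : α → F} {s : Set α} {a b : ℝ} (hs : MeasurableSet s) (ha : 0 ≤ a)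
    (hf : ∀ w ∈ s, ‖f w‖ ≤ a) (hν : ν s ≤ ENNReal.ofReal b) :
    ∫⁻ w in s, ‖f w‖ₑ ∂ν ≤ ENNReal.ofReal (a * b) := by
  calc ∫⁻ w in s, ‖f w‖ₑ ∂ν ≤ ∫⁻ _ in s, ENNReal.ofReal a ∂ν := by
        refine setLIntegral_mono' hs fun w hw => ?_
        rw [← ofReal_norm]
        exact ENNReal.ofReal_le_ofReal (hf w hw)
    _ = ENNReal.ofReal a * ν s := by simp
    _ ≤ ENNReal.ofReal a * ENNReal.ofReal b := by gcongr
    _ = _ := by rw [ENNReal.ofReal_mul ha]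

lemma tsum_ofReal_mul_half_pow {c : ℝ} (hc : 0 ≤ c) :
    ∑' k : ℕ, ENNReal.ofReal (c * (1 / 2) ^ k) = ENNReal.ofReal (c * 2) := by
  rw [← ENNReal.ofReal_tsum_of_nonneg (fun k => by positivity)
    (summable_geometric_two.mul_left c), tsum_mul_left, tsum_geometric_two]

variable {E : Type*} [NormedAddCommGroup E] [NormedSpace ℝ E] [MeasurableSpace E]

/-- The measure of the balls centred at `x` is at most `D` times the `d`-th power of the radius,
where `d` is the dimension of the space. -/
def HasGrowthAt (ν : Measure E) (D : ℝ) (x : E) : Prop :=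
  ∀ r : ℝ, 0 < r → ν (ball x r) ≤ ENNReal.ofReal (D * r ^ finrank ℝ E)

lemma HasGrowthAt.mono_measure {ν ν' : Measure E} {D : ℝ} {x : E} (h : HasGrowthAt ν D x)
    (hν : ν' ≤ ν) : HasGrowthAt ν' D x := fun r hr => (hν _).trans (h r hr)

/-- In positive dimension the growth bound tends to 0 with the radius. This discards the centre from
the near integrals, where the hypotheses on the kernel say nothing. -/
lemma HasGrowthAt.singleton_eq_zero [FiniteDimensional ℝ E] [Nontrivial E] {ν : Measure E} {D : ℝ}
    {x : E} (h : HasGrowthAt ν D x) : ν {x} = 0 := by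
  have hd : finrank ℝ E ≠ 0 := finrank_pos.ne'
  have h1 : Tendsto (fun r : ℝ => ENNReal.ofReal (D * r ^ finrank ℝ E)) (𝓝[>] 0) (𝓝 0) := by
    have : Tendsto (fun r : ℝ => ENNReal.ofReal (D * r ^ finrank ℝ E)) (𝓝 0)
        (𝓝 (ENNReal.ofReal (D * 0 ^ finrank ℝ E))) :=
      ((ENNReal.continuous_ofReal.comp (by fun_prop)).tendsto 0)
    simp only [ne_eq, hd, not_false_eq_true, zero_pow, mul_zero, ENNReal.ofReal_zero] at this
    exact this.mono_left nhdsWithin_le_nhds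
  refine le_antisymm (ge_of_tendsto h1 ?_) zero_le
  filter_upwards [self_mem_nhdsWithin] with r hr
  exact (measure_mono (by simpa using hr)).trans (h r hr)

variable [BorelSpace E]

/-- A function of size at most `A / ‖w - x‖ ^ (d + 1)` has small integral off large balls, for a
measure of `d`-dimensional growth at `x`. -/
lemma HasGrowthAt.lintegral_compl_ball_le {ν : Measure E} {D : ℝ} {x : E} (h : HasGrowthAt ν D x)
    (hD : 0 ≤ D) {F : Type*} [NormedAddCommGroup F] {f : E → F} {A r : ℝ} (hA : 0 ≤ A) (hr : 0 < r)
    (hf : ∀ w, r ≤ ‖w - x‖ → ‖f w‖ ≤ A / ‖w - x‖ ^ (finrank ℝ E + 1)) :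
    ∫⁻ w in (ball x r)ᶜ, ‖f w‖ₑ ∂ν ≤ ENNReal.ofReal (2 ^ (finrank ℝ E + 1) * A * D / r) := by
  set d := finrank ℝ E with hd
  -- Dyadic shells: on the k-th one the bound for f decays like 2^(-k(d+1)) and the measure grows
  -- like 2^(kd), which leaves a geometric series of ratio 1/2.
  set s : ℕ → Set E := fun k => {w | 2 ^ k * r ≤ ‖w - x‖ ∧ ‖w - x‖ < 2 ^ (k + 1) * r} with hs
  have hsm : ∀ k, MeasurableSet (s k) := fun k => by
    refine MeasurableSet.inter ?_ ?_
    · exact measurableSet_le measurable_const (measurable_id.sub_const x).norm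
    · exact measurableSet_lt (measurable_id.sub_const x).norm measurable_const
  have hcov : (ball x r)ᶜ ⊆ ⋃ k, s k := by
    intro w hw
    have h1 : r ≤ ‖w - x‖ := by simpa [dist_eq_norm] using hw
    obtain ⟨k, hk1, hk2⟩ := exists_nat_pow_near (x := ‖w - x‖ / r) (y := (2 : ℝ))
      (by rw [one_le_div hr]; exact h1) (by norm_num)
    rw [le_div_iff₀ hr] at hk1
    rw [div_lt_iff₀ hr] at hk2
    exact mem_iUnion.2 ⟨k, hk1, hk2⟩
  have hk : ∀ k, ∫⁻ w in s k, ‖f w‖ₑ ∂ν ≤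
      ENNReal.ofReal ((2 ^ d * A * D / r) * (1 / 2) ^ k) := by
    intro k
    have hp : (1 : ℝ) ≤ 2 ^ k := one_le_pow₀ (by norm_num)
    have h1 : ∀ w ∈ s k, ‖f w‖ ≤ A / (2 ^ k * r) ^ (d + 1) := by
      rintro w ⟨hw1, hw2⟩
      refine (hf w (by nlinarith)).trans ?_
      gcongr
    have h2 : ν (s k) ≤ ENNReal.ofReal (D * (2 ^ (k + 1) * r) ^ d) := by
      refine (measure_mono ?_).trans (h _ (by positivity))
      rintro w ⟨_, hw⟩
      rwa [mem_ball, dist_eq_norm]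
    refine (setLIntegral_enorm_le_of_norm_le (hsm k) (by positivity) h1 h2).trans_eq ?_
    congr 1
    rw [pow_succ (2 : ℝ) k]
    simp only [mul_pow, div_pow, one_pow]
    field_simp
    ring
  calc ∫⁻ w in (ball x r)ᶜ, ‖f w‖ₑ ∂ν ≤ ∫⁻ w in ⋃ k, s k, ‖f w‖ₑ ∂ν := lintegral_mono_set hcov
    _ ≤ ∑' k, ∫⁻ w in s k, ‖f w‖ₑ ∂ν := lintegral_iUnion_le _ _
    _ ≤ ∑' k, ENNReal.ofReal ((2 ^ d * A * D / r) * (1 / 2) ^ k) :=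
        ENNReal.tsum_le_tsum hk
    _ = _ := by
        rw [tsum_ofReal_mul_half_pow (by positivity)]; congr 1; ring

variable [FiniteDimensional ℝ E] [Nontrivial E]

/-- A function of size at most `A / ‖w - x‖ ^ (d - 1)` has small integral over small balls, for a
measure of `d`-dimensional growth at `x`. -/
lemma HasGrowthAt.lintegral_ball_le {ν : Measure E} {D : ℝ} {x : E} (h : HasGrowthAt ν D x)
    (hD : 0 ≤ D) {F : Type*} [NormedAddCommGroup F] {f : E → F} {A r : ℝ} (hA : 0 ≤ A) (hr : 0 < r)
    (hf : ∀ w ∈ ball x r, w ≠ x → ‖f w‖ ≤ A / ‖w - x‖ ^ (finrank ℝ E - 1)) :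
    ∫⁻ w in ball x r, ‖f w‖ₑ ∂ν ≤ ENNReal.ofReal (4 ^ finrank ℝ E * A * D * r) := by
  obtain ⟨n, hn⟩ : ∃ n, finrank ℝ E = n + 1 := Nat.exists_eq_succ_of_ne_zero finrank_pos.ne'
  -- Shells shrinking to x: the bound for f grows like 2^(k(d-1)) and the measure decays like
  -- 2^(-kd). Taking the bound at the inner radius and the mass in an open ball of twice the outer
  -- radius produces the factor 4^d.
  set s : ℕ → Set E := fun k => ball x r ∩ {w | (1 / 2) ^ (k + 1) * r < ‖w - x‖ ∧
    ‖w - x‖ ≤ (1 / 2) ^ k * r} with hs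
  have hsm : ∀ k, MeasurableSet (s k) := fun k => by
    refine measurableSet_ball.inter (MeasurableSet.inter ?_ ?_)
    · exact measurableSet_lt measurable_const (measurable_id.sub_const x).norm
    · exact measurableSet_le (measurable_id.sub_const x).norm measurable_const
  have hcov : ball x r ⊆ {x} ∪ ⋃ k, s k := by
    intro w hw
    by_cases hwx : w = x
    · exact Or.inl hwx
    · right
      have h0 : 0 < ‖w - x‖ := norm_pos_iff.2 (sub_ne_zero.2 hwx)
      have h1 : ‖w - x‖ < r := by simpa [dist_eq_norm] using hw
      obtain ⟨k, hk1, hk2⟩ := exists_nat_pow_near_of_lt_one (x := ‖w - x‖ / r) (y := (1 / 2 : ℝ))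
        (by positivity) (by rw [div_le_one hr]; exact h1.le) (by norm_num) (by norm_num)
      rw [lt_div_iff₀ hr] at hk1
      rw [div_le_iff₀ hr] at hk2
      exact mem_iUnion.2 ⟨k, hw, hk1, hk2⟩
  have hk : ∀ k, ∫⁻ w in s k, ‖f w‖ₑ ∂ν ≤
      ENNReal.ofReal ((4 ^ (n + 1) * A * D * r / 2) * (1 / 2) ^ k) := by
    intro k
    have hp : (0 : ℝ) < (1 / 2) ^ k := by positivity
    have h1 : ∀ w ∈ s k, ‖f w‖ ≤ A / ((1 / 2) ^ (k + 1) * r) ^ n := by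
      rintro w ⟨hwb, hw1, hw2⟩
      have hpos : 0 < (1 / 2) ^ (k + 1) * r := by positivity
      have hwx : w ≠ x := by
        rintro rfl
        simp only [sub_self, norm_zero] at hw1
        linarith
      refine (hf w hwb hwx).trans ?_
      rw [hn, Nat.add_sub_cancel]
      gcongr
    have h2 : ν (s k) ≤ ENNReal.ofReal (D * (2 * ((1 / 2) ^ k * r)) ^ (n + 1)) := by
      rw [← hn]
      refine (measure_mono ?_).trans (h _ (by positivity))
      rintro w ⟨_, _, hw⟩
      rw [mem_ball, dist_eq_norm]
      have : 0 < (1 / 2) ^ k * r := by positivity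
      linarith
    refine (setLIntegral_enorm_le_of_norm_le (hsm k) (by positivity) h1 h2).trans_eq ?_
    congr 1
    have : (4 : ℝ) ^ (n + 1) = 2 ^ n * 2 ^ n * 4 := by
      rw [← mul_pow]; norm_num [pow_succ]
    rw [this, pow_succ (1 / 2 : ℝ) k]
    simp only [mul_pow, div_pow, one_pow]
    field_simp
    ring
  calc ∫⁻ w in ball x r, ‖f w‖ₑ ∂ν ≤ ∫⁻ w in {x} ∪ ⋃ k, s k, ‖f w‖ₑ ∂ν := lintegral_mono_set hcov
    _ ≤ ∫⁻ w in {x}, ‖f w‖ₑ ∂ν + ∫⁻ w in ⋃ k, s k, ‖f w‖ₑ ∂ν := lintegral_union_le _ _ _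
    _ = ∫⁻ w in ⋃ k, s k, ‖f w‖ₑ ∂ν := by
        rw [setLIntegral_measure_zero _ _ h.singleton_eq_zero, zero_add]
    _ ≤ ∑' k, ∫⁻ w in s k, ‖f w‖ₑ ∂ν := lintegral_iUnion_le _ _
    _ ≤ ∑' k, ENNReal.ofReal ((4 ^ (n + 1) * A * D * r / 2) * (1 / 2) ^ k) :=
        ENNReal.tsum_le_tsum hk
    _ = _ := by rw [tsum_ofReal_mul_half_pow (by positivity), hn]; congr 1; ring

/-- An additive Haar measure has growth at every point. -/
lemma hasGrowthAt_addHaar (μ : Measure E) [μ.IsAddHaarMeasure] (x : E) :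
    HasGrowthAt μ (μ (ball 0 1)).toReal x := fun r hr => by
  rw [Measure.addHaar_ball μ x hr.le, mul_comm (ENNReal.toReal _), ENNReal.ofReal_mul (by positivity),
    ENNReal.ofReal_toReal measure_ball_lt_top.ne]

end Growth


/-! ### The weak type (1, 1) of the maximal function of a measure -/

section Maximal

variable {E : Type*} [NormedAddCommGroup E] [InnerProductSpace ℝ E] [FiniteDimensional ℝ E]
  [MeasurableSpace E] [BorelSpace E]

/-- The set where the Hardy–Littlewood maximal function of a measure exceeds `t`. -/
def maximalLevelSet (ν : Measure E) (t : ℝ≥0∞) : Set E :=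
  {x | ∃ r : ℝ, 0 < r ∧ t * volume (ball x r) < ν (ball x r)}

/-- A ball is the increasing union of concentric smaller balls, so one of radius r - 1/(n+1) already
carries enough mass. It lies in every ball of radius r whose centre is moved by less than 1/(n+1).
-/
lemma isOpen_maximalLevelSet (ν : Measure E) (t : ℝ≥0∞) : IsOpen (maximalLevelSet ν t) := by
  have h : maximalLevelSet ν t = ⋃ (r : ℝ) (_ : 0 < r), {x | t * volume (ball (0 : E) r) < ν (ball x r)} := by
    ext x
    simp only [maximalLevelSet, mem_ofPred_eq, mem_iUnion, exists_prop,
      Measure.addHaar_ball_center volume x]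
  rw [h]
  refine isOpen_iUnion fun r => isOpen_iUnion fun hr => isOpen_iff_mem_nhds.2 fun x hx => ?_
  have hmono : Monotone fun n : ℕ => ball x (r - 1 / (n + 1)) := fun m n hmn =>
    ball_subset_ball (by
      have : (1 : ℝ) / (n + 1) ≤ 1 / (m + 1) := by gcongr
      linarith)
  have hU : ⋃ n : ℕ, ball x (r - 1 / (n + 1)) = ball x r := by
    refine subset_antisymm (iUnion_subset fun n => ball_subset_ball ?_) fun y hy => ?_
    · have : (0 : ℝ) < 1 / (n + 1) := by positivity
      linarith
    · obtain ⟨n, hn⟩ := exists_nat_one_div_lt (sub_pos.2 (mem_ball.1 hy))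
      exact mem_iUnion.2 ⟨n, mem_ball.2 (by linarith)⟩
  have hx' : t * volume (ball (0 : E) r) < ⨆ n : ℕ, ν (ball x (r - 1 / (n + 1))) := by
    rw [← hmono.measure_iUnion, hU]
    exact hx
  obtain ⟨n, hn⟩ := lt_iSup_iff.1 hx'
  filter_upwards [ball_mem_nhds x (show (0 : ℝ) < 1 / (n + 1) by positivity)] with y hy
  refine hn.trans_le (measure_mono (ball_subset_ball' ?_))
  rw [dist_comm]
  linarith [mem_ball.1 hy]

lemma measure_ball_le_of_notMem_maximalLevelSet {ν : Measure E} {t : ℝ≥0∞} {x : E}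
    (hx : x ∉ maximalLevelSet ν t) {r : ℝ} (hr : 0 < r) : ν (ball x r) ≤ t * volume (ball x r) := by
  by_contra h
  exact hx ⟨r, hr, not_le.1 h⟩

lemma volume_ball_const_mul [Nontrivial E] (x y : E) {r c : ℝ} (hc : 0 ≤ c) :
    volume (ball x (c * r)) = ENNReal.ofReal (c ^ finrank ℝ E) * volume (ball y r) := by
  rw [Measure.addHaar_ball_mul volume x hc, Measure.addHaar_ball_center volume y]

variable [Nontrivial E]

/-- Supplies the bounded radii that the Vitali covering lemma requires. The maximum with 1 is there
because r ≤ r^d needs r ≥ 1. -/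
lemma exists_radius_bound (a : ℝ≥0∞) (ha : a ≠ ∞) :
    ∃ R : ℝ, ∀ (x : E) (r : ℝ), volume (ball x r) ≤ a → r ≤ R := by
  have hv : volume (ball (0 : E) 1) ≠ 0 := (measure_ball_pos _ _ one_pos).ne'
  have hb : a / volume (ball (0 : E) 1) ≠ ∞ := ENNReal.div_ne_top ha hv
  refine ⟨max 1 (a / volume (ball (0 : E) 1)).toReal, fun x r h => ?_⟩
  rcases le_total r 1 with hr | hr
  · exact le_max_of_le_left hr
  refine le_max_of_le_right ?_
  rw [Measure.addHaar_ball volume x (zero_le_one.trans hr),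
    ← ENNReal.le_div_iff_mul_le (Or.inl hv) (Or.inl measure_ball_lt_top.ne)] at h
  calc r ≤ r ^ finrank ℝ E := le_self_pow₀ hr finrank_pos.ne'
    _ ≤ _ := (ENNReal.ofReal_le_iff_le_toReal hb).1 h

/-- The weak type `(1, 1)` inequality for the maximal function of a finite measure. -/
theorem mul_volume_maximalLevelSet_le (ν : Measure E) [IsFiniteMeasure ν] {t : ℝ≥0∞} (ht : t ≠ 0) :
    t * volume (maximalLevelSet ν t) ≤ 4 ^ finrank ℝ E * ν univ := by
  rcases eq_or_ne t ∞ with rfl | ht'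
  · have : maximalLevelSet ν ∞ = ∅ := by
      refine eq_empty_of_forall_notMem ?_
      rintro x ⟨r, hr, h⟩
      rw [ENNReal.top_mul (measure_ball_pos _ _ hr).ne'] at h
      exact not_top_lt h
    simp [this]
  have hd : ENNReal.ofReal (4 ^ finrank ℝ E) = 4 ^ finrank ℝ E := by
    rw [ENNReal.ofReal_pow (by norm_num)]; norm_num
  obtain ⟨R, hR⟩ := exists_radius_bound (E := E) (ν univ / t)
    (ENNReal.div_ne_top (measure_ne_top _ _) ht)
  choose! r hr using fun x (hx : x ∈ maximalLevelSet ν t) => hx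
  -- The chosen radii are bounded, since t |B(x, r)| < ν(B(x, r)) ≤ ν(E). The enlargement factor 4
  -- is the source of the constant 4^d.
  obtain ⟨u, hu, hdisj, hcov⟩ := Vitali.exists_disjoint_subfamily_covering_enlargement_ball
    (maximalLevelSet ν t) (fun x => x) r R (fun x hx => hR x _ (by
      rw [ENNReal.le_div_iff_mul_le (Or.inl ht) (Or.inl ht'), mul_comm]
      exact (hr x hx).2.le.trans (measure_mono (subset_univ _)))) 4 (by norm_num)
  have hcount : u.Countable := hdisj.countable_of_isOpen (fun _ _ => isOpen_ball)
    fun x hx => nonempty_ball.2 (hr x (hu hx)).1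
  calc t * volume (maximalLevelSet ν t) ≤ t * volume (⋃ x ∈ u, ball x (4 * r x)) := by
        gcongr
        intro x hx
        obtain ⟨y, hy, hxy⟩ := hcov x hx
        exact mem_biUnion hy (hxy (mem_ball_self (hr x hx).1))
    _ ≤ t * ∑' x : u, volume (ball (x : E) (4 * r x)) := by
        gcongr; exact measure_biUnion_le _ hcount _
    _ = ∑' x : u, 4 ^ finrank ℝ E * (t * volume (ball (x : E) (r x))) := by
        rw [← ENNReal.tsum_mul_left]
        refine tsum_congr fun x => ?_
        rw [volume_ball_const_mul _ (x : E) (by norm_num), hd]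
        ring
    _ ≤ ∑' x : u, 4 ^ finrank ℝ E * ν (ball (x : E) (r x)) := by
        gcongr with x
        exact (hr x (hu x.2)).2.le
    _ = 4 ^ finrank ℝ E * ν (⋃ x ∈ u, ball x (r x)) := by
        rw [ENNReal.tsum_mul_left, measure_biUnion hcount hdisj fun _ _ => measurableSet_ball]
    _ ≤ _ := by gcongr; exact subset_univ _

end Maximal

/-! ### Whitney decomposition of an open set -/

section Whitney

variable {X : Type*} [PseudoMetricSpace X] [SecondCountableTopology X] [MeasurableSpace X]
  [BorelSpace X]

/-- A Whitney decomposition of an open set into sets comparable to balls. -/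
theorem exists_whitney_decomposition {U : Set X} (hU : IsOpen U) (hne : Uᶜ.Nonempty) {R : ℝ}
    (hR : ∀ x ∈ U, infDist x Uᶜ ≤ R) :
    ∃ (u : Set X) (Q : X → Set X), u.Countable ∧ u ⊆ U ∧ (∀ y ∈ u, MeasurableSet (Q y)) ∧
      u.PairwiseDisjoint Q ∧ ⋃ y ∈ u, Q y = U ∧
      ∀ y ∈ u, ball y (infDist y Uᶜ / 20) ⊆ Q y ∧ Q y ⊆ ball y (infDist y Uᶜ / 5) := by
  -- The fourfold enlargement of a ball of this radius has a fifth of the distance to the complement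
  -- as its radius, so it stays well inside U.
  set ρ : X → ℝ := fun y => infDist y Uᶜ / 20 with hρ
  have hpos : ∀ y ∈ U, 0 < ρ y := fun y hy => by
    have : 0 < infDist y Uᶜ := (hU.isClosed_compl.notMem_iff_infDist_pos hne).1 (by simpa using hy)
    positivity
  have hρ5 : ∀ y, 4 * ρ y = infDist y Uᶜ / 5 := fun y => by simp only [hρ]; ring
  obtain ⟨u, hu, hdisj, hcov⟩ := Vitali.exists_disjoint_subfamily_covering_enlargement_ball
    U (fun x => x) ρ (R / 20) (fun x hx => by have := hR x hx; simp only [hρ]; linarith) 4 (by norm_num)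
  have hcount : u.Countable := hdisj.countable_of_isOpen (fun _ _ => isOpen_ball)
    fun x hx => nonempty_ball.2 (hpos x (hu hx))
  obtain ⟨e, he⟩ := countable_iff_exists_injOn.1 hcount
  set G : Set X := ⋃ z ∈ u, ball z (ρ z) with hG
  -- Each cell owns its core ball; any other point goes to the first enlarged ball, in the
  -- enumeration e, that contains it. The cores are disjoint and the enlarged balls cover U, so the
  -- cells partition U.
  set Q : X → Set X := fun y => ball y (ρ y) ∪
    ((ball y (4 * ρ y) \ G) \ ⋃ z ∈ {z ∈ u | e z < e y}, ball z (4 * ρ z)) with hQ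
  have hsub : ∀ y ∈ u, Q y ⊆ ball y (4 * ρ y) := by
    intro y hy
    refine union_subset (ball_subset_ball ?_) (sdiff_subset.trans sdiff_subset)
    have := hpos y (hu hy)
    linarith
  have hball : ∀ y ∈ u, ball y (4 * ρ y) ⊆ U := by
    intro y hy
    rw [hρ5]
    intro z hz
    by_contra hzU
    have h1 := infDist_le_dist_of_mem (x := y) (show z ∈ Uᶜ from hzU)
    have h2 := mem_ball'.1 hz
    have h3 := hpos y (hu hy)
    simp only [hρ] at h3
    linarith
  have hlt : ∀ y ∈ u, ∀ z ∈ u, e y < e z → Disjoint (Q y) (Q z) := by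
    intro y hy z hz hyz
    have hne : y ≠ z := by rintro rfl; exact lt_irrefl _ hyz
    rw [Set.disjoint_left]
    rintro x hx (hxz | ⟨⟨-, hxG⟩, hxz⟩)
    · rcases hx with hx | ⟨⟨-, hxG⟩, -⟩
      · exact Set.disjoint_left.1 (hdisj hy hz hne) hx hxz
      · exact hxG (mem_biUnion hz hxz)
    · exact hxz (mem_biUnion (show y ∈ {y ∈ u | e y < e z} from ⟨hy, hyz⟩) (hsub y hy hx))
  refine ⟨u, Q, hcount, hu, fun y _ => ?_, ?_, ?_, fun y hy => ⟨subset_union_left, ?_⟩⟩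
  · refine measurableSet_ball.union ((measurableSet_ball.diff ?_).diff ?_)
    · exact MeasurableSet.biUnion hcount fun _ _ => measurableSet_ball
    · exact MeasurableSet.biUnion (hcount.mono (sep_subset _ _)) fun _ _ => measurableSet_ball
  · intro y hy z hz hyz
    rcases lt_or_gt_of_ne (he.ne hy hz hyz) with h | h
    · exact hlt y hy z hz h
    · exact (hlt z hz y hy h).symm
  · refine subset_antisymm (iUnion₂_subset fun y hy => (hsub y hy).trans (hball y hy)) ?_
    intro x hx
    by_cases hxG : x ∈ G
    · obtain ⟨z, hz, hxz⟩ := mem_iUnion₂.1 hxG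
      exact mem_biUnion hz (Or.inl hxz)
    · obtain ⟨y, hy, hxy⟩ := hcov x hx
      have hex : {z ∈ u | x ∈ ball z (4 * ρ z)}.Nonempty := ⟨y, hy, hxy (mem_ball_self (hpos x hx))⟩
      obtain ⟨z, ⟨hz, hxz⟩, hmin⟩ : ∃ z ∈ {z ∈ u | x ∈ ball z (4 * ρ z)},
          ∀ w ∈ {z ∈ u | x ∈ ball z (4 * ρ z)}, e z ≤ e w := by
        obtain ⟨z, hz, hmin⟩ := WellFounded.has_min (InvImage.wf e wellFounded_lt) _ hex
        exact ⟨z, hz, fun w hw => not_lt.1 (hmin w hw)⟩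
      refine mem_biUnion hz (Or.inr ⟨⟨hxz, hxG⟩, fun h => ?_⟩)
      obtain ⟨w, ⟨hw, hwz⟩, hxw⟩ := mem_iUnion₂.1 h
      exact (hmin w ⟨hw, hxw⟩).not_gt hwz
  · rw [← hρ5]; exact hsub y hy

end Whitney

/-! ### The Calderón–Zygmund decomposition of a finite measure -/

section CalderonZygmund

/-- Equal total masses allow the constant a to be subtracted from f in both integrals. This is the
cancellation used on each Whitney cell. -/
lemma enorm_integral_sub_integral_le {α : Type*} [MeasurableSpace α] {ν γ : Measure α}
    [IsFiniteMeasure ν] [IsFiniteMeasure γ] (h : γ univ = ν univ) {f : α → ℝ} (hν : Integrable f ν)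
    (hγ : Integrable f γ) (a : ℝ) {δ : ℝ≥0∞} (hδν : ∀ᵐ z ∂ν, ‖f z - a‖ₑ ≤ δ)
    (hδγ : ∀ᵐ z ∂γ, ‖f z - a‖ₑ ≤ δ) :
    ‖∫ z, f z ∂ν - ∫ z, f z ∂γ‖ₑ ≤ 2 * ν univ * δ := by
  have h1 : ∫ z, f z ∂ν - ∫ z, f z ∂γ = ∫ z, (f z - a) ∂ν - ∫ z, (f z - a) ∂γ := by
    rw [integral_sub hν (integrable_const _), integral_sub hγ (integrable_const _)]
    simp [measureReal_def, h]
  rw [h1]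
  calc ‖∫ z, (f z - a) ∂ν - ∫ z, (f z - a) ∂γ‖ₑ
      ≤ ‖∫ z, (f z - a) ∂ν‖ₑ + ‖∫ z, (f z - a) ∂γ‖ₑ := enorm_sub_le
    _ ≤ ∫⁻ z, ‖f z - a‖ₑ ∂ν + ∫⁻ z, ‖f z - a‖ₑ ∂γ :=
        add_le_add (enorm_integral_le_lintegral_enorm _) (enorm_integral_le_lintegral_enorm _)
    _ ≤ ∫⁻ _, δ ∂ν + ∫⁻ _, δ ∂γ := add_le_add (lintegral_mono_ae hδν) (lintegral_mono_ae hδγ)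
    _ = _ := by simp only [lintegral_const, h]; ring

variable {E : Type*} [NormedAddCommGroup E] [InnerProductSpace ℝ E] [FiniteDimensional ℝ E]
  [MeasurableSpace E] [BorelSpace E] [Nontrivial E]

/-- Off the level set of its maximal function, a measure is dominated by Lebesgue measure. -/
lemma restrict_compl_maximalLevelSet_le (ν : Measure E) [IsFiniteMeasure ν] (t : ℝ≥0) :
    ν.restrict (maximalLevelSet ν t)ᶜ ≤
      ((2 ^ finrank ℝ E * t : ℝ≥0) • volume : Measure E).restrict (maximalLevelSet ν t)ᶜ := by
  refine Measure.le_iff.2 fun s hs => ?_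
  rw [Measure.restrict_apply hs, Measure.restrict_apply hs]
  -- Differentiation along the Besicovitch family of ν reduces the comparison to small closed balls
  -- centred off the level set. Replacing the closed ball of radius r by the open one of radius 2r
  -- costs the factor 2^d.
  refine (Besicovitch.vitaliFamily ν).measure_le_of_frequently_le _ Measure.AbsolutelyContinuous.rfl
    _ fun x hx => ?_
  refine (Besicovitch.tendsto_filterAt ν x).frequently (Eventually.frequently ?_)
  filter_upwards [self_mem_nhdsWithin] with r hr
  have hr : 0 < r := hr
  calc ν (closedBall x r) ≤ ν (ball x (2 * r)) :=
        measure_mono (closedBall_subset_ball (by linarith))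
    _ ≤ t * volume (ball x (2 * r)) :=
        measure_ball_le_of_notMem_maximalLevelSet hx.2 (by positivity)
    _ = (2 ^ finrank ℝ E * t : ℝ≥0) * volume (ball x r) := by
        rw [volume_ball_const_mul x x (by norm_num), ENNReal.ofReal_pow (by norm_num)]
        push_cast
        rw [ENNReal.ofReal_ofNat]
        ring
    _ ≤ _ := by
        rw [Measure.smul_apply, ENNReal.smul_def, smul_eq_mul]
        gcongr
        exact ball_subset_closedBall

/-- The Calderón–Zygmund decomposition of a finite measure `ν` at height `t`: the good part `γ`
has density at most a multiple of `t`, and the integrals against `ν` and `γ` differ by the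
oscillations over a family of balls in an exceptional set. -/
theorem exists_calderonZygmund_decomposition (ν : Measure E) [IsFiniteMeasure ν] {t : ℝ≥0}
    (ht : 0 < t) :
    ∃ (U : Set E) (γ : Measure E) (u : Set E) (s : E → ℝ) (m : E → ℝ≥0∞), MeasurableSet U ∧
      t * volume U ≤ 4 ^ finrank ℝ E * ν univ ∧ γ univ = ν univ ∧
      γ ≤ (44 ^ finrank ℝ E * t : ℝ≥0) • volume ∧ u.Countable ∧ (∀ y ∈ u, 0 < s y) ∧
      (∀ y ∈ u, ball y (2 * s y) ⊆ U) ∧ ∑' y : u, m y ≤ ν univ ∧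
      ∀ f : E → ℝ, Integrable f ν → Integrable f γ → ∀ δ : E → ℝ≥0∞,
        (∀ y ∈ u, ∀ z ∈ ball y (s y), ‖f z - f y‖ₑ ≤ δ y) →
        ‖∫ z, f z ∂ν - ∫ z, f z ∂γ‖ₑ ≤ ∑' y : u, 2 * m y * δ y := by
  set U := maximalLevelSet ν t with hUdef
  have hd : finrank ℝ E ≠ 0 := finrank_pos.ne'
  have ht0 : (t : ℝ≥0∞) ≠ 0 := by exact_mod_cast ht.ne'
  have hUo : IsOpen U := isOpen_maximalLevelSet ν t
  have hvolU : t * volume U ≤ 4 ^ finrank ℝ E * ν univ := mul_volume_maximalLevelSet_le ν ht0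
  have hfin : volume U ≠ ∞ := by
    intro h
    rw [h, ENNReal.mul_top ht0] at hvolU
    exact (ENNReal.mul_lt_top (ENNReal.pow_lt_top (by norm_num)) (measure_lt_top ν _)).not_ge hvolU
  have hne : Uᶜ.Nonempty := by
    rw [nonempty_compl]
    intro h
    exact hfin (by rw [h]; exact measure_univ_of_isAddLeftInvariant _)
  obtain ⟨R, hR⟩ := exists_radius_bound (E := E) _ hfin
  obtain ⟨u, Q, hu, huU, hQm, hQd, hQU, hQb⟩ := exists_whitney_decomposition hUo hne (R := R)
    fun x hx => hR x _ (measure_mono fun z hz => by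
      by_contra hzU
      exact (infDist_le_dist_of_mem (x := x) (show z ∈ Uᶜ from hzU)).not_gt (mem_ball'.1 hz))
  have hpos : ∀ y ∈ u, 0 < infDist y Uᶜ := fun y hy =>
    (hUo.isClosed_compl.notMem_iff_infDist_pos hne).1 (by simpa using huU hy)
  have : Countable u := hu.to_subtype
  have hvQ0 : ∀ y ∈ u, volume (Q y) ≠ 0 := fun y hy =>
    ((measure_ball_pos volume y (by have := hpos y hy; positivity)).trans_le
      (measure_mono (hQb y hy).1)).ne'
  have hvQ1 : ∀ y ∈ u, volume (Q y) ≠ ∞ := fun y hy =>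
    ((measure_mono (hQb y hy).2).trans_lt measure_ball_lt_top).ne
  have hcQ : ∀ y ∈ u, ν (Q y) ≤ (44 ^ finrank ℝ E * t : ℝ≥0) * volume (Q y) := by
    intro y hy
    -- With δ the distance from y to the complement, p lies off U within 2δ of y. So the cell, of
    -- radius at most δ/5, is contained in the ball about p of radius 11δ/5 = 44 · δ/20; the cell
    -- contains a ball of radius δ/20, hence 44^d.
    obtain ⟨p, hp, hyp⟩ := (infDist_lt_iff hne (x := y) (r := 2 * infDist y Uᶜ)).1
      (by have := hpos y hy; linarith)
    have hpy := hpos y hy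
    calc ν (Q y) ≤ ν (ball p (44 * (infDist y Uᶜ / 20))) := by
          refine measure_mono ((hQb y hy).2.trans (ball_subset_ball' ?_))
          linarith
      _ ≤ t * volume (ball p (44 * (infDist y Uᶜ / 20))) :=
          measure_ball_le_of_notMem_maximalLevelSet hp (by positivity)
      _ = (44 ^ finrank ℝ E * t : ℝ≥0) * volume (ball y (infDist y Uᶜ / 20)) := by
          rw [volume_ball_const_mul p y (by norm_num), ENNReal.ofReal_pow (by norm_num)]
          push_cast
          rw [ENNReal.ofReal_ofNat]
          ring
      _ ≤ _ := by gcongr; exact (hQb y hy).1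
  -- The mass of ν on the cell, spread uniformly over it.
  set η : u → Measure E := fun y => (ν (Q y) / volume (Q y)) • volume.restrict (Q y) with hη
  have hηu : ∀ y : u, η y univ = ν (Q y) := fun y => by
    simp [hη, ENNReal.div_mul_cancel (hvQ0 y y.2) (hvQ1 y y.2)]
  have hQU' : ⋃ y : u, Q y = U := by rw [← hQU, biUnion_eq_iUnion]
  have hQd' : Pairwise (Function.onFun Disjoint fun y : u => Q y) := fun y z hyz =>
    hQd y.2 z.2 (fun h => hyz (Subtype.ext h))
  have hQm' : ∀ y : u, MeasurableSet (Q y) := fun y => hQm y y.2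
  have hsumQ : ∑' y : u, ν (Q y) = ν U := by
    rw [← hQU', measure_iUnion hQd' hQm']
  set γ : Measure E := ν.restrict Uᶜ + Measure.sum η with hγ
  have hsumη : Measure.sum η univ = ν U := by
    rw [Measure.sum_apply _ MeasurableSet.univ, ← hsumQ]
    exact tsum_congr hηu
  have hγu : γ univ = ν univ := by
    rw [hγ, Measure.add_apply, hsumη, Measure.restrict_apply_univ, add_comm,
      measure_add_measure_compl hUo.measurableSet]
  -- The ball of radius s y contains the cell and its double still lies in U. Points off U are
  -- therefore at distance at least 2 s y from y, as the kernel estimates require.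
  refine ⟨U, γ, u, fun y => infDist y Uᶜ / 5, fun y => ν (Q y), hUo.measurableSet, hvolU, hγu,
    ?_, hu, fun y hy => by have := hpos y hy; positivity, ?_, ?_, ?_⟩
  · set c : ℝ≥0 := 44 ^ finrank ℝ E * t with hc
    have h1 : ν.restrict Uᶜ ≤ (c • volume : Measure E).restrict Uᶜ := by
      refine (restrict_compl_maximalLevelSet_le ν t).trans (Measure.restrict_mono_measure ?_ _)
      refine Measure.le_iff.2 fun s _ => ?_
      simp only [Measure.smul_apply, ENNReal.smul_def, smul_eq_mul]
      gcongr
      rw [hc]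
      gcongr
      norm_num
    have h2 : Measure.sum η ≤ (c • volume : Measure E).restrict U := by
      rw [← hQU', Measure.restrict_iUnion hQd' hQm']
      refine Measure.le_iff.2 fun s hs => ?_
      rw [Measure.sum_apply _ hs, Measure.sum_apply _ hs]
      refine ENNReal.tsum_le_tsum fun y => ?_
      simp only [hη, Measure.restrict_smul, Measure.smul_apply, ENNReal.smul_def, smul_eq_mul]
      gcongr
      exact ENNReal.div_le_of_le_mul (hcQ y y.2)
    calc γ ≤ (c • volume : Measure E).restrict Uᶜ + (c • volume : Measure E).restrict U :=
          add_le_add h1 h2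
      _ = c • volume := by
          rw [add_comm, Measure.restrict_add_restrict_compl hUo.measurableSet]
  · intro y hy z hz
    by_contra hzU
    have h1 := infDist_le_dist_of_mem (x := y) (show z ∈ Uᶜ from hzU)
    have h2 := mem_ball'.1 hz
    have h3 := hpos y hy
    linarith
  · rw [hsumQ]; exact measure_mono (subset_univ _)
  · intro f hfν hfγ δ hδ
    have hfs : Integrable f (Measure.sum η) := (integrable_add_measure.1 hfγ).2
    have e1 : ∫ z, f z ∂ν = ∫ z in Uᶜ, f z ∂ν + ∫ z in U, f z ∂ν := by
      rw [add_comm, integral_add_compl hUo.measurableSet hfν]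
    have e2 : ∫ z, f z ∂γ = ∫ z in Uᶜ, f z ∂ν + ∫ z, f z ∂(Measure.sum η) :=
      integral_add_measure hfν.integrableOn hfs
    have hs1 : HasSum (fun y : u => ∫ z in Q y, f z ∂ν) (∫ z in U, f z ∂ν) := by
      rw [← hQU']
      exact hasSum_integral_iUnion hQm' hQd' hfν.integrableOn
    have hs2 : HasSum (fun y : u => ∫ z, f z ∂(η y)) (∫ z, f z ∂(Measure.sum η)) :=
      hasSum_integral_measure hfs
    rw [e1, e2, add_sub_add_left_eq_sub, ← (hs1.sub hs2).tsum_eq]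
    refine enorm_tsum_le_tsum_enorm.trans
      (ENNReal.tsum_le_tsum fun y => ?_)
    have : IsFiniteMeasure (η y) := ⟨by rw [hηu]; exact measure_lt_top _ _⟩
    have hb : ∀ z ∈ Q y, ‖f z - f y‖ₑ ≤ δ y := fun z hz => hδ y y.2 z ((hQb y y.2).2 hz)
    refine (enorm_integral_sub_integral_le (by rw [hηu, Measure.restrict_apply_univ])
      hfν.integrableOn (hfs.mono_measure (Measure.le_sum η y)) (f y) ?_ ?_).trans_eq
      (by rw [Measure.restrict_apply_univ])
    · exact (ae_restrict_iff' (hQm' y)).2 (Eventually.of_forall hb)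
    · exact Measure.ae_smul_measure ((ae_restrict_iff' (hQm' y)).2 (Eventually.of_forall hb)) _

end CalderonZygmund


/-! ### Kernels of order 1 - d and their smooth cutoffs -/

section Kernel

variable {E : Type*} [NormedAddCommGroup E] [InnerProductSpace ℝ E]

/-- `k` is twice continuously differentiable off the origin, with the size and derivative bounds
of a kernel of order `1 - d` in dimension `d`. -/
def HasKernelBound (A : ℝ) (k : E → ℝ) : Prop :=
  ContDiffOn ℝ 2 k {0}ᶜ ∧
    ∀ j : ℕ, j ≤ 2 → ∀ x : E, x ≠ 0 → ‖iteratedFDeriv ℝ j k x‖ ≤ A / ‖x‖ ^ (finrank ℝ E - 1 + j)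

namespace HasKernelBound

variable {A B : ℝ} {k l : E → ℝ}

lemma contDiffAt (h : HasKernelBound A k) {x : E} (hx : x ≠ 0) : ContDiffAt ℝ 2 k x :=
  h.1.contDiffAt (isOpen_compl_singleton.mem_nhds hx)

lemma mono (h : HasKernelBound A k) (hAB : A ≤ B) : HasKernelBound B k :=
  ⟨h.1, fun j hj x hx => (h.2 j hj x hx).trans (by gcongr)⟩

lemma sub (hk : HasKernelBound A k) (hl : HasKernelBound B l) :
    HasKernelBound (A + B) (fun x => k x - l x) := by
  refine ⟨hk.1.sub hl.1, fun j hj x hx => ?_⟩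
  have hj' : (j : WithTop ℕ∞) ≤ 2 := by exact_mod_cast hj
  have : iteratedFDeriv ℝ j (fun x => k x - l x) x
      = iteratedFDeriv ℝ j k x - iteratedFDeriv ℝ j l x :=
    iteratedFDeriv_sub_apply ((hk.contDiffAt hx).of_le hj') ((hl.contDiffAt hx).of_le hj')
  rw [this, add_div]
  exact (norm_sub_le _ _).trans (add_le_add (hk.2 j hj x hx) (hl.2 j hj x hx))

lemma norm_le (h : HasKernelBound A k) {x : E} (hx : x ≠ 0) :
    ‖k x‖ ≤ A / ‖x‖ ^ (finrank ℝ E - 1) := by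
  simpa using h.2 0 (by norm_num) x hx

variable [FiniteDimensional ℝ E] [Nontrivial E]

lemma nonneg (h : HasKernelBound A k) : 0 ≤ A := by
  obtain ⟨x, hx⟩ := exists_ne (0 : E)
  have h1 := (norm_nonneg _).trans (h.norm_le hx)
  have h2 : 0 < ‖x‖ ^ (finrank ℝ E - 1) := pow_pos (norm_pos_iff.2 hx) _
  rw [le_div_iff₀ h2, zero_mul] at h1
  exact h1

lemma norm_fderiv_le (h : HasKernelBound A k) {x : E} (hx : x ≠ 0) :
    ‖fderiv ℝ k x‖ ≤ A / ‖x‖ ^ finrank ℝ E := by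
  have := h.2 1 (by norm_num) x hx
  rwa [← norm_iteratedFDeriv_fderiv, norm_iteratedFDeriv_zero,
    Nat.sub_add_cancel finrank_pos] at this

lemma norm_fderiv_fderiv_le (h : HasKernelBound A k) {x : E} (hx : x ≠ 0) :
    ‖fderiv ℝ (fderiv ℝ k) x‖ ≤ A / ‖x‖ ^ (finrank ℝ E + 1) := by
  have := h.2 2 le_rfl x hx
  rwa [show (2 : ℕ) = 0 + 1 + 1 from rfl, ← norm_iteratedFDeriv_fderiv,
    ← norm_iteratedFDeriv_fderiv, norm_iteratedFDeriv_zero, zero_add, ← add_assoc,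
    Nat.sub_add_cancel finrank_pos] at this

lemma differentiableAt_fderiv (h : HasKernelBound A k) {x : E} (hx : x ≠ 0) :
    DifferentiableAt ℝ (fderiv ℝ k) x :=
  ((h.contDiffAt hx).fderiv_right (m := 1) (by norm_num)).differentiableAt (by norm_num)

/-- The Lipschitz bound for the derivative of a kernel, away from the origin. -/
lemma norm_fderiv_sub_le (h : HasKernelBound A k) {u v : E} (hu : u ≠ 0)
    (huv : ‖v - u‖ ≤ ‖u‖ / 2) :
    ‖fderiv ℝ k v - fderiv ℝ k u‖ ≤ 2 ^ (finrank ℝ E + 1) * A / ‖u‖ ^ (finrank ℝ E + 1) * ‖v - u‖ := by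
  have hu0 : 0 < ‖u‖ := norm_pos_iff.2 hu
  have hz : ∀ z ∈ closedBall u (‖u‖ / 2), ‖u‖ / 2 ≤ ‖z‖ := by
    intro z hz
    have h1 : ‖z - u‖ ≤ ‖u‖ / 2 := by simpa [dist_eq_norm] using hz
    have h2 := norm_sub_norm_le u z
    rw [norm_sub_rev] at h2
    linarith
  have hz0 : ∀ z ∈ closedBall u (‖u‖ / 2), z ≠ 0 := fun z h => norm_pos_iff.1 (by linarith [hz z h])
  refine (convex_closedBall u (‖u‖ / 2)).norm_image_sub_le_of_norm_fderiv_le (𝕜 := ℝ)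
    (fun z hz => h.differentiableAt_fderiv (hz0 z hz)) (fun z h' => ?_)
    (mem_closedBall_self (by positivity)) (by simpa [dist_eq_norm] using huv)
  have hA := h.nonneg
  calc _ ≤ A / ‖z‖ ^ (finrank ℝ E + 1) := h.norm_fderiv_fderiv_le (hz0 z h')
    _ ≤ A / (‖u‖ / 2) ^ (finrank ℝ E + 1) := by gcongr; exact hz z h'
    _ = _ := by rw [div_pow]; field_simp

/-- The first order Taylor formula for a kernel, away from the origin. -/
lemma norm_sub_sub_fderiv_le (h : HasKernelBound A k) {u v : E} (hu : u ≠ 0)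
    (huv : ‖v - u‖ ≤ ‖u‖ / 2) :
    ‖k v - k u - fderiv ℝ k u (v - u)‖ ≤
      2 ^ (finrank ℝ E + 1) * A / ‖u‖ ^ (finrank ℝ E + 1) * ‖v - u‖ ^ 2 := by
  have hA := h.nonneg
  have hz : ∀ z ∈ closedBall u ‖v - u‖, ‖z - u‖ ≤ ‖v - u‖ := fun z hz => by
    simpa [dist_eq_norm] using hz
  have hu0 : 0 < ‖u‖ := norm_pos_iff.2 hu
  have hz0 : ∀ z ∈ closedBall u ‖v - u‖, z ≠ 0 := by
    rintro z h' rfl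
    have := hz 0 h'
    rw [zero_sub, norm_neg] at this
    linarith
  have := (convex_closedBall u ‖v - u‖).norm_image_sub_le_of_norm_fderiv_le' (𝕜 := ℝ)
    (f := k) (φ := fderiv ℝ k u)
    (C := 2 ^ (finrank ℝ E + 1) * A / ‖u‖ ^ (finrank ℝ E + 1) * ‖v - u‖)
    (fun z hz => (h.contDiffAt (hz0 z hz)).differentiableAt (by norm_num)) (fun z h' => ?_)
    (mem_closedBall_self (by positivity)) (y := v) (by simp [dist_eq_norm])
  · rwa [pow_two, ← mul_assoc]
  · refine (h.norm_fderiv_sub_le hu ((hz z h').trans huv)).trans ?_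
    gcongr
    exact hz z h'

/-- A kernel vanishing near the origin has bounded derivative. -/
lemma norm_fderiv_le_of_eq_zero (h : HasKernelBound A k) {ε : ℝ} (hε : 0 < ε)
    (h0 : ∀ x ∈ ball (0 : E) ε, k x = 0) (x : E) : ‖fderiv ℝ k x‖ ≤ A / ε ^ finrank ℝ E := by
  have hA := h.nonneg
  rcases lt_or_ge ‖x‖ ε with hx | hx
  · have : k =ᶠ[𝓝 x] fun _ => 0 := by
      filter_upwards [isOpen_ball.mem_nhds (show x ∈ ball (0 : E) ε by simpa using hx)] with y hy
      exact h0 y hy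
    rw [this.fderiv_eq, fderiv_fun_const]
    simp only [Pi.zero_apply, norm_zero]
    positivity
  · refine (h.norm_fderiv_le (norm_pos_iff.1 (hε.trans_le hx))).trans ?_
    gcongr

/-- A kernel vanishing near the origin has Lipschitz derivative. -/
lemma norm_fderiv_sub_le_of_eq_zero (h : HasKernelBound A k) (hk : ContDiff ℝ 2 k) {ε : ℝ}
    (hε : 0 < ε) (h0 : ∀ x ∈ ball (0 : E) ε, k x = 0) (u v : E) :
    ‖fderiv ℝ k v - fderiv ℝ k u‖ ≤ A / ε ^ (finrank ℝ E + 1) * ‖v - u‖ := by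
  have hA := h.nonneg
  refine convex_univ.norm_image_sub_le_of_norm_fderiv_le (𝕜 := ℝ)
    (fun z _ => (hk.fderiv_right (m := 1) (by norm_num)).differentiable (by norm_num) z)
    (fun z _ => ?_) (mem_univ u) (mem_univ v)
  rcases lt_or_ge ‖z‖ ε with hz | hz
  · have : k =ᶠ[𝓝 z] fun _ => 0 := by
      filter_upwards [isOpen_ball.mem_nhds (show z ∈ ball (0 : E) ε by simpa using hz)] with y hy
      exact h0 y hy
    rw [this.fderiv.fderiv_eq]
    simp only [fderiv_fun_const, Pi.zero_apply, Pi.zero_def, norm_zero]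
    positivity
  · refine (h.norm_fderiv_fderiv_le (norm_pos_iff.1 (hε.trans_le hz))).trans ?_
    gcongr

end HasKernelBound

variable [FiniteDimensional ℝ E]

variable (E) in
/-- A fixed smooth bump function, equal to `1` on the unit ball and supported in the ball of
radius `2`. -/
noncomputable def unitBump : ContDiffBump (0 : E) := ⟨1, 2, one_pos, one_lt_two⟩

/-- The kernel `k` smoothly cut off at scale `ε`: it vanishes on the ball of radius `ε` and agrees
with `k` off the ball of radius `2 * ε`. -/
noncomputable def cutoff (ε : ℝ) (k : E → ℝ) (x : E) : ℝ := k x - unitBump E (ε⁻¹ • x) * k x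

lemma unitBump_smul_eq_one {ε : ℝ} (hε : 0 < ε) {x : E} (hx : ‖x‖ ≤ ε) :
    unitBump E (ε⁻¹ • x) = 1 := by
  refine (unitBump E).one_of_mem_closedBall ?_
  rw [mem_closedBall_zero_iff, norm_smul, norm_inv, Real.norm_of_nonneg hε.le]
  exact (inv_mul_le_iff₀ hε).2 (by simpa [unitBump] using hx)

lemma unitBump_smul_eq_zero {ε : ℝ} (hε : 0 < ε) {x : E} (hx : 2 * ε ≤ ‖x‖) :
    unitBump E (ε⁻¹ • x) = 0 := by
  refine (unitBump E).zero_of_le_dist ?_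
  rw [dist_zero_right, norm_smul, norm_inv, Real.norm_of_nonneg hε.le]
  exact (le_inv_mul_iff₀ hε).2 (by simpa [unitBump, mul_comm] using hx)

lemma cutoff_eq_zero {ε : ℝ} (hε : 0 < ε) (k : E → ℝ) {x : E} (hx : ‖x‖ ≤ ε) :
    cutoff ε k x = 0 := by
  simp [cutoff, unitBump_smul_eq_one hε hx]

lemma cutoff_eq {ε : ℝ} (hε : 0 < ε) (k : E → ℝ) {x : E} (hx : 2 * ε ≤ ‖x‖) :
    cutoff ε k x = k x := by
  simp [cutoff, unitBump_smul_eq_zero hε hx]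

lemma contDiff_unitBump_smul (ε : ℝ) {n : ℕ∞} : ContDiff ℝ n fun x : E => unitBump E (ε⁻¹ • x) :=
  (unitBump E).contDiff.comp (contDiff_const_smul _)

lemma contDiff_cutoff {ε : ℝ} (hε : 0 < ε) {k : E → ℝ} (hk : ContDiffOn ℝ 2 k {0}ᶜ) :
    ContDiff ℝ 2 (cutoff ε k) := by
  refine contDiff_iff_contDiffAt.2 fun x => ?_
  by_cases hx : x = 0
  · have : cutoff ε k =ᶠ[𝓝 x] fun _ => 0 := by
      filter_upwards [ball_mem_nhds x hε] with y hy
      exact cutoff_eq_zero hε k (by simpa [hx] using (mem_ball.1 hy).le)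
    exact contDiffAt_const.congr_of_eventuallyEq this
  · have h1 := hk.contDiffAt (isOpen_compl_singleton.mem_nhds hx)
    exact h1.sub ((contDiff_unitBump_smul ε).contDiffAt.mul h1)

variable (E) in
-- The quantity |x|^j |D^j f(x)| is invariant under dilations, so the value for the dilated bump at
-- x is the value for the fixed bump at x / ε. That one is continuous with compact support, hence
-- bounded.
lemma exists_unitBump_bound : ∃ c : ℝ, 0 ≤ c ∧ ∀ j : ℕ, j ≤ 2 → ∀ (ε : ℝ) (x : E),
    ‖x‖ ^ j * ‖iteratedFDeriv ℝ j (fun x : E => unitBump E (ε⁻¹ • x)) x‖ ≤ c := by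
  have h1 : ∀ j : ℕ, ∃ c : ℝ, ∀ x : E, ‖x‖ ^ j * ‖iteratedFDeriv ℝ j (unitBump E) x‖ ≤ c := by
    intro j
    have hs : HasCompactSupport fun x : E => ‖x‖ ^ j * ‖iteratedFDeriv ℝ j (unitBump E) x‖ :=
      ((unitBump E).hasCompactSupport.iteratedFDeriv j).norm.mul_left
    have hc : Continuous fun x : E => ‖x‖ ^ j * ‖iteratedFDeriv ℝ j (unitBump E) x‖ :=
      (continuous_norm.pow j).mul (((unitBump E).contDiff (n := j)).continuous_iteratedFDeriv le_rfl).norm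
    obtain ⟨c, hc⟩ := hs.exists_bound_of_continuous hc
    exact ⟨c, fun x => (le_abs_self _).trans (hc x)⟩
  choose c hc using h1
  have hc0 : ∀ j, 0 ≤ c j := fun j => (by positivity : (0 : ℝ) ≤ _).trans (hc j 0)
  refine ⟨∑ j ∈ Finset.range 3, c j, Finset.sum_nonneg fun j _ => hc0 j, fun j hj ε x => ?_⟩
  refine le_trans ?_ (Finset.single_le_sum (fun j _ => hc0 j)
    (Finset.mem_range.2 (by omega : j < 3)))
  rw [iteratedFDeriv_comp_const_smul _ ((unitBump E).contDiff (n := j))]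
  refine le_trans (le_of_eq ?_) (hc j (ε⁻¹ • x))
  simp only [norm_smul, mul_pow, norm_pow]
  ring

variable (E) in
/-- Cutting off a kernel preserves the kernel bounds, uniformly in the scale. -/
theorem exists_hasKernelBound_cutoff : ∃ c : ℝ, 1 ≤ c ∧ ∀ (A : ℝ) (k : E → ℝ),
    HasKernelBound A k → 0 ≤ A → ∀ ε : ℝ, HasKernelBound (c * A) (cutoff ε k) := by
  obtain ⟨c, hc0, hc⟩ := exists_unitBump_bound E
  refine ⟨1 + 4 * c, by linarith, fun A k hk hA ε => ?_⟩
  have h1 : HasKernelBound (4 * c * A) fun x => unitBump E (ε⁻¹ • x) * k x := by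
    refine ⟨(contDiff_unitBump_smul ε).contDiffOn.mul hk.1, fun j hj x hx => ?_⟩
    have hj' : (j : WithTop ℕ∞) ≤ 2 := by exact_mod_cast hj
    have hx0 : 0 < ‖x‖ := norm_pos_iff.2 hx
    have hO : IsOpen ({0}ᶜ : Set E) := isOpen_compl_singleton
    have h := norm_iteratedFDerivWithin_mul_le (𝕜 := ℝ) (N := 2) (s := {0}ᶜ)
      (f := fun x : E => unitBump E (ε⁻¹ • x)) (g := k)
      (contDiff_unitBump_smul ε).contDiffOn hk.1 hO.uniqueDiffOn (x := x) hx (n := j) hj'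
    simp only [iteratedFDerivWithin_of_isOpen _ hO hx] at h
    refine h.trans ?_
    calc _ ≤ ∑ i ∈ Finset.range (j + 1), (j.choose i : ℝ) *
          (c * A / ‖x‖ ^ (finrank ℝ E - 1 + j)) := by
          refine Finset.sum_le_sum fun i hi => ?_
          have hi : i ≤ j := by have := Finset.mem_range.1 hi; omega
          rw [mul_assoc]
          gcongr
          have e1 : ‖iteratedFDeriv ℝ i (fun x : E => unitBump E (ε⁻¹ • x)) x‖ ≤ c / ‖x‖ ^ i := by
            rw [le_div_iff₀ (by positivity), mul_comm]
            exact hc i (by omega) ε x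
          have e2 := hk.2 (j - i) (by omega) x hx
          calc _ ≤ c / ‖x‖ ^ i * (A / ‖x‖ ^ (finrank ℝ E - 1 + (j - i))) := by gcongr
            _ = c * A / ‖x‖ ^ (finrank ℝ E - 1 + j) := by
                rw [div_mul_div_comm, ← pow_add]
                congr 2
                omega
      -- The binomial coefficients of the Leibniz formula sum to 2^j ≤ 4, which gives the 4 in the
      -- constant 1 + 4c.
      _ = 2 ^ j * (c * A / ‖x‖ ^ (finrank ℝ E - 1 + j)) := by
          rw [← Finset.sum_mul, ← Nat.cast_sum, Nat.sum_range_choose]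
          push_cast; rfl
      _ ≤ 2 ^ 2 * (c * A / ‖x‖ ^ (finrank ℝ E - 1 + j)) := by
          gcongr
          norm_num
      _ = _ := by ring
  have := hk.sub h1
  exact this.mono (by linarith)

end Kernel

end

section

open Metric Set Filter Topology Module FourierTransform

/-! ### Plancherel's theorem and Fourier multiplier bounds for integrable functions -/

section Plancherel

variable {V : Type*} [NormedAddCommGroup V] [InnerProductSpace ℝ V] [FiniteDimensional ℝ V]
  [MeasurableSpace V] [BorelSpace V]

lemma continuous_fourier_of_integrable {f : V → ℂ} (hf : Integrable f) : Continuous (𝓕 f) :=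
  VectorFourier.fourierIntegral_continuous Real.continuous_fourierChar continuous_inner hf

lemma norm_fourier_le_integral_norm {F : Type*} [NormedAddCommGroup F] [NormedSpace ℂ F]
    (f : V → F) (ξ : V) : ‖𝓕 f ξ‖ ≤ ∫ x, ‖f x‖ :=
  VectorFourier.norm_fourierIntegral_le_integral_norm Real.fourierChar volume (innerₗ V) f ξ

/-- The Fourier transform on `L²` is given by the Fourier integral on integrable functions. -/
lemma fourier_toLp_ae_eq {f : V → ℂ} (hf : Integrable f) (hf2 : MemLp f 2 volume) :
    (𝓕 (hf2.toLp f) : Lp ℂ 2 (volume : Measure V)) =ᵐ[volume] 𝓕 f := by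
  -- Both sides are tested against smooth compactly supported g. On the left the transform moves
  -- onto g by definition of the transform of a tempered distribution, on the right by Fubini.
  refine ae_eq_of_integral_contDiff_smul_eq
    ((Lp.memLp (𝓕 (hf2.toLp f) : Lp ℂ 2 (volume : Measure V))).locallyIntegrable (by norm_num))
    (continuous_fourier_of_integrable hf).locallyIntegrable fun g hg hgs => ?_
  have hgc : ContDiff ℝ (⊤ : ℕ∞) fun x => (g x : ℂ) := Complex.ofRealCLM.contDiff.comp hg
  have hgcs : HasCompactSupport fun x => (g x : ℂ) := hgs.comp_left (g := fun r : ℝ => (r : ℂ)) rfl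
  set φ : SchwartzMap V ℂ := hgcs.toSchwartzMap hgc with hφ
  have h1 := congrArg (fun T => T φ) (Lp.fourier_toTemperedDistribution_eq (hf2.toLp f))
  simp only [TemperedDistribution.fourier_apply, Lp.toTemperedDistribution_apply] at h1
  have h2 : ∫ x, (𝓕 φ) x • (hf2.toLp f : V → ℂ) x = ∫ x, (𝓕 φ) x • f x := by
    refine integral_congr_ae ?_
    filter_upwards [hf2.coeFn_toLp] with x hx
    rw [hx]
  have h3 : ∫ x, (𝓕 φ) x • f x = ∫ x, φ x • 𝓕 f x := by
    have := VectorFourier.integral_fourierIntegral_smul_eq_flip (L := innerₗ V) (μ := volume)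
      (ν := volume) Real.continuous_fourierChar continuous_inner φ.integrable hf
    rw [flip_innerₗ] at this
    exact this
  have h4 : ∀ x, φ x = (g x : ℂ) := fun x => rfl
  simp only [Complex.real_smul]
  rw [h2, h3] at h1
  simpa [h4] using h1.symm

/-- Plancherel's theorem for square-integrable integrable functions. -/
lemma eLpNorm_fourier_eq {f : V → ℂ} (hf : Integrable f) (hf2 : MemLp f 2 volume) :
    eLpNorm (𝓕 f) 2 = eLpNorm f 2 := by
  have h := Lp.norm_fourier_eq (hf2.toLp f)
  rw [Lp.norm_def, Lp.norm_def, ENNReal.toReal_eq_toReal_iff' (Lp.eLpNorm_ne_top _)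
    (Lp.eLpNorm_ne_top _), eLpNorm_congr_ae hf2.coeFn_toLp,
    eLpNorm_congr_ae (fourier_toLp_ae_eq hf hf2)] at h
  exact h

lemma memLp_two_of_integrable_of_bound {α : Type*} [MeasurableSpace α] {μ : Measure α} {f : α → ℂ}
    (hf : Integrable f μ) {M : ℝ} (hM : ∀ᵐ x ∂μ, ‖f x‖ ≤ M) : MemLp f 2 μ := by
  rw [memLp_two_iff_integrable_sq_norm hf.1]
  refine (hf.norm.const_mul M).mono' (hf.1.norm.pow 2) ?_
  filter_upwards [hM] with x hx
  rw [norm_pow, norm_norm, pow_two]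
  gcongr

open Convolution in
/-- Young's inequality for the convolution with a kernel with bounded Fourier transform. -/
lemma eLpNorm_convolution_le_of_norm_fourier_le {f H : V → ℂ} (hf : Integrable f) (hf2 : MemLp f 2)
    (hH : Integrable H) {M : ℝ} (hM : ∀ x, ‖H x‖ ≤ M) {C : ℝ≥0} (hC : ∀ᵐ ξ, ‖𝓕 H ξ‖ ≤ C) :
    eLpNorm (fun x => ∫ y, f y * H (x - y)) 2 ≤ C * eLpNorm f 2 := by
  set L := ContinuousLinearMap.mul ℂ ℂ with hL
  have hconv : (f ⋆[L, volume] H) = fun x => ∫ y, f y * H (x - y) := by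
    ext x; simp [convolution_def, hL]
  have hint : Integrable (f ⋆[L, volume] H) := hf.integrable_convolution L hH
  -- The convolution is integrable and bounded, hence square-integrable, so Plancherel applies to it
  -- directly.
  have hbd : ∀ x, ‖(f ⋆[L, volume] H) x‖ ≤ (∫ y, ‖f y‖) * M := fun x => by
    rw [hconv, ← integral_mul_const]
    refine norm_integral_le_of_norm_le (hf.norm.mul_const M) (Eventually.of_forall fun y => ?_)
    rw [norm_mul]
    gcongr
    exact hM _
  have h2 := memLp_two_of_integrable_of_bound hint (Eventually.of_forall hbd)
  rw [← hconv, ← eLpNorm_fourier_eq hint h2, ← eLpNorm_fourier_eq hf hf2]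
  have := eLpNorm_le_nnreal_smul_eLpNorm_of_ae_le_mul (f := 𝓕 (f ⋆[L, volume] H)) (g := 𝓕 f)
    (c := C) (μ := volume) (p := 2) (by
      filter_upwards [hC] with ξ hξ
      rw [Real.fourier_mul_convolution_eq hf hH, nnnorm_mul, mul_comm]
      gcongr
      exact hξ)
  simpa [ENNReal.smul_def] using this

lemma norm_fourier_fderiv {F : Type*} [NormedAddCommGroup F] [NormedSpace ℂ F] {f : V → F}
    (hf : Integrable f) (h'f : Differentiable ℝ f) (hf' : Integrable (fderiv ℝ f)) (ξ : V) :
    ‖𝓕 (fderiv ℝ f) ξ‖ = 2 * Real.pi * ‖ξ‖ * ‖𝓕 f ξ‖ := by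
  rw [Real.fourier_fderiv hf h'f hf', VectorFourier.norm_fourierSMulRight, neg_apply,
    norm_neg, innerSL_apply_norm]

/-- A derivative multiplies the size of the transform by 2π|ξ|. It is used with f the derivative of
the far part of a kernel, where the second derivative has a good L¹ bound. -/
lemma norm_mul_norm_fourier_le_integral_norm_fderiv {F : Type*} [NormedAddCommGroup F]
    [NormedSpace ℂ F] {f : V → F} (hf : ContDiff ℝ 1 f) (hs : HasCompactSupport f) (ξ : V) :
    2 * Real.pi * ‖ξ‖ * ‖𝓕 f ξ‖ ≤ ∫ x, ‖fderiv ℝ f x‖ := by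
  rw [← norm_fourier_fderiv (hf.continuous.integrable_of_hasCompactSupport hs)
    (hf.differentiable (by norm_num))
    ((hf.continuous_fderiv (by norm_num)).integrable_of_hasCompactSupport (hs.fderiv ℝ))]
  exact norm_fourier_le_integral_norm _ _

end Plancherel

/-! ### The L² bound for smooth singular integrals -/

section Multiplier

lemma lintegral_eq_setLIntegral_of_eq_zero {α : Type*} [MeasurableSpace α] {μ : Measure α}
    {f : α → ℝ≥0∞} {s : Set α} (hs : MeasurableSet s) (hf : ∀ x ∉ s, f x = 0) :
    ∫⁻ x, f x ∂μ = ∫⁻ x in s, f x ∂μ := by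
  rw [← lintegral_indicator hs, indicator_eq_self.2]
  exact Function.support_subset_iff'.2 hf

lemma hasCompactSupport_cutoff {E : Type*} [NormedAddCommGroup E] [InnerProductSpace ℝ E]
    [FiniteDimensional ℝ E] {k : E → ℝ} (hk : HasCompactSupport k) (ε : ℝ) :
    HasCompactSupport (cutoff ε k) :=
  hk.mono' (fun x hx => subset_tsupport _ fun h => hx (by simp [cutoff, h]))

lemma norm_fderiv_fderiv_ofReal {E : Type*} [NormedAddCommGroup E] [NormedSpace ℝ E]
    (k : E → ℝ) (hk : ContDiff ℝ 2 k) (x : E) :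
    ‖fderiv ℝ (fderiv ℝ fun x => (k x : ℂ)) x‖ = ‖fderiv ℝ (fderiv ℝ k) x‖ := by
  have h := LinearIsometry.norm_iteratedFDeriv_comp_left Complex.ofRealLI (hk.contDiffAt (x := x))
    (i := 2) le_rfl
  rw [show (2 : ℕ) = 0 + 1 + 1 from rfl, ← norm_iteratedFDeriv_fderiv,
    ← norm_iteratedFDeriv_fderiv, norm_iteratedFDeriv_zero, ← norm_iteratedFDeriv_fderiv,
    ← norm_iteratedFDeriv_fderiv, norm_iteratedFDeriv_zero] at h
  exact h

variable {E : Type*} [NormedAddCommGroup E] [InnerProductSpace ℝ E] [FiniteDimensional ℝ E]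
  [MeasurableSpace E] [BorelSpace E] [Nontrivial E]

variable (E) in
/-- The Fourier transform of the derivative of a smooth kernel is bounded by the kernel constant. -/
theorem exists_norm_fourier_fderiv_le : ∃ c : ℝ, 0 ≤ c ∧ ∀ (A : ℝ) (k : E → ℝ),
    HasKernelBound A k → ContDiff ℝ 2 k → HasCompactSupport k → ∀ ξ : E, ξ ≠ 0 →
      ‖𝓕 (fderiv ℝ fun x => (k x : ℂ)) ξ‖ ≤ c * A := by
  obtain ⟨c, hc1, hc⟩ := exists_hasKernelBound_cutoff E
  set d := finrank ℝ E with hd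
  set v := (volume (ball (0 : E) 1)).toReal with hv
  have hv0 : 0 ≤ v := ENNReal.toReal_nonneg
  refine ⟨2 * Real.pi * (4 ^ d * (1 + c) * v * 2) + 2 ^ (d + 1) * c * v / (2 * Real.pi),
    by positivity, fun A k hk hk2 hks ξ hξ => ?_⟩
  have hA := hk.nonneg
  have hξ0 : 0 < ‖ξ‖ := norm_pos_iff.2 hξ
  -- The kernel is split at the wavelength of ξ. The near part a satisfies |𝓕(Da)(ξ)| ≤ 2π|ξ| ‖a‖₁
  -- with ‖a‖₁ = O(r); the far part b satisfies 2π|ξ| |𝓕(Db)(ξ)| ≤ ‖D²b‖₁ = O(1/r). With r = 1/|ξ|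
  -- both are O(A).
  set r := ‖ξ‖⁻¹ with hr
  have hr0 : 0 < r := inv_pos.2 hξ0
  set b := cutoff r k with hb
  set a : E → ℝ := fun x => k x - b x with ha
  have hbK : HasKernelBound (c * A) b := hc A k hk hA r
  have haK : HasKernelBound (A + c * A) a := hk.sub hbK
  have hb2 : ContDiff ℝ 2 b := contDiff_cutoff hr0 hk.1
  have ha2 : ContDiff ℝ 2 a := hk2.sub hb2
  have hbs : HasCompactSupport b := hasCompactSupport_cutoff hks r
  have has : HasCompactSupport a := hks.sub hbs
  have comp2 : ∀ {f : E → ℝ}, ContDiff ℝ 2 f → ContDiff ℝ 2 fun x => (f x : ℂ) := fun hf =>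
    Complex.ofRealCLM.contDiff.comp hf
  have comps : ∀ {f : E → ℝ}, HasCompactSupport f → HasCompactSupport fun x => (f x : ℂ) :=
    fun hf => hf.comp_left (g := fun r : ℝ => (r : ℂ)) rfl
  have int1 : ∀ {f : E → ℝ}, ContDiff ℝ 2 f → HasCompactSupport f →
      Integrable (fderiv ℝ fun x => (f x : ℂ)) := fun hf hfs =>
    ((comp2 hf).continuous_fderiv (by norm_num)).integrable_of_hasCompactSupport
      ((comps hfs).fderiv ℝ)
  have int0 : ∀ {f : E → ℝ}, ContDiff ℝ 2 f → HasCompactSupport f →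
      Integrable (fun x => (f x : ℂ)) := fun hf hfs =>
    (comp2 hf).continuous.integrable_of_hasCompactSupport (comps hfs)
  have hsum : (fderiv ℝ fun x => (k x : ℂ)) =
      (fderiv ℝ fun x => (a x : ℂ)) + fderiv ℝ fun x => (b x : ℂ) := by
    ext1 x
    rw [Pi.add_apply, ← fderiv_fun_add ((comp2 ha2).differentiable (by norm_num) x)
      ((comp2 hb2).differentiable (by norm_num) x)]
    congr 1
    ext y
    simp [ha]
  have hfa : ‖𝓕 (fderiv ℝ fun x => (a x : ℂ)) ξ‖ ≤
      2 * Real.pi * (4 ^ d * (1 + c) * v * 2) * A := by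
    rw [norm_fourier_fderiv (int0 ha2 has) ((comp2 ha2).differentiable (by norm_num))
      (int1 ha2 has)]
    have h1 : ∫ x, ‖(a x : ℂ)‖ ≤ 4 ^ d * (A + c * A) * v * (2 * r) := by
      rw [integral_norm_eq_lintegral_enorm (int0 ha2 has).1]
      refine ENNReal.toReal_le_of_le_ofReal (by positivity) ?_
      have h2 : ∀ x ∉ ball (0 : E) (2 * r), ‖(a x : ℂ)‖ₑ = 0 := fun x hx => by
        have : 2 * r ≤ ‖x‖ := by simpa using hx
        simp [ha, hb, cutoff_eq hr0 k this]
      rw [lintegral_eq_setLIntegral_of_eq_zero measurableSet_ball h2]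
      refine (hasGrowthAt_addHaar volume (0 : E)).lintegral_ball_le hv0 haK.nonneg
        (by positivity) fun w _ hw => ?_
      rw [sub_zero, Complex.norm_real]
      exact haK.norm_le hw
    calc 2 * Real.pi * ‖ξ‖ * ‖𝓕 (fun x => (a x : ℂ)) ξ‖
        ≤ 2 * Real.pi * ‖ξ‖ * (4 ^ d * (A + c * A) * v * (2 * r)) := by
          gcongr
          exact (norm_fourier_le_integral_norm _ _).trans h1
      _ = _ := by rw [hr]; field_simp
  have hfb : ‖𝓕 (fderiv ℝ fun x => (b x : ℂ)) ξ‖ ≤ 2 ^ (d + 1) * c * v / (2 * Real.pi) * A := by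
    have h0 := norm_mul_norm_fourier_le_integral_norm_fderiv
      (f := fderiv ℝ fun x => (b x : ℂ)) ((comp2 hb2).fderiv_right (by norm_num))
      ((comps hbs).fderiv ℝ) ξ
    simp only [norm_fderiv_fderiv_ofReal _ hb2] at h0
    set u : E → ℝ := fun x => ‖fderiv ℝ (fderiv ℝ b) x‖ with hu
    have huc : Continuous u :=
      ((hb2.fderiv_right (m := 1) (by norm_num)).continuous_fderiv (by norm_num)).norm
    have h1 : ∫ x, u x ≤ 2 ^ (d + 1) * (c * A) * v / r := by
      have hun : ∀ x, u x = ‖u x‖ := fun x => (Real.norm_of_nonneg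
        (show 0 ≤ u x from norm_nonneg (fderiv ℝ (fderiv ℝ b) x))).symm
      rw [integral_congr_ae (Eventually.of_forall hun),
        integral_norm_eq_lintegral_enorm huc.aestronglyMeasurable]
      refine ENNReal.toReal_le_of_le_ofReal (by positivity) ?_
      have h2 : ∀ x ∉ (ball (0 : E) r)ᶜ, ‖u x‖ₑ = 0 := by
        intro x hx
        have hx : x ∈ ball (0 : E) r := by simpa using hx
        have : b =ᶠ[𝓝 x] fun _ => 0 := by
          filter_upwards [isOpen_ball.mem_nhds hx] with y hy
          exact cutoff_eq_zero hr0 k (by simpa using (mem_ball.1 hy).le)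
        have hux : u x = ‖fderiv ℝ (fderiv ℝ b) x‖ := rfl
        rw [enorm_eq_zero, hux, this.fderiv.fderiv_eq]
        simp only [fderiv_fun_const, Pi.zero_apply, Pi.zero_def]
        exact norm_zero (E := E →L[ℝ] E →L[ℝ] ℝ)
      rw [lintegral_eq_setLIntegral_of_eq_zero measurableSet_ball.compl h2]
      refine (hasGrowthAt_addHaar volume (0 : E)).lintegral_compl_ball_le hv0 hbK.nonneg
        hr0 fun w hw => ?_
      rw [sub_zero] at hw ⊢
      rw [← hun]
      exact hbK.norm_fderiv_fderiv_le (norm_pos_iff.1 (hr0.trans_le hw))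
    have h3 := h0.trans h1
    have h4 : 2 ^ (d + 1) * (c * A) * v / r = 2 * Real.pi * ‖ξ‖ *
        (2 ^ (d + 1) * c * v / (2 * Real.pi) * A) := by
      rw [hr]; field_simp
    rw [h4] at h3
    exact le_of_mul_le_mul_left h3 (by positivity)
  have hadd : 𝓕 (fderiv ℝ fun x => (k x : ℂ)) ξ =
      𝓕 (fderiv ℝ fun x => (a x : ℂ)) ξ + 𝓕 (fderiv ℝ fun x => (b x : ℂ)) ξ := by
    rw [hsum]
    have := VectorFourier.fourierIntegral_add Real.continuous_fourierChar
      (L := innerₗ E) continuous_inner (int1 ha2 has) (int1 hb2 hbs)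
    exact congrFun this ξ
  rw [hadd, add_mul]
  exact (norm_add_le _ _).trans (add_le_add hfa hfb)

lemma ae_rnDeriv_le_of_le_smul {α : Type*} [MeasurableSpace α] {γ μ : Measure α} [SigmaFinite μ]
    {c : ℝ≥0} (h : γ ≤ c • μ) : γ.rnDeriv μ ≤ᵐ[μ] fun _ => (c : ℝ≥0∞) := by
  refine ae_le_of_forall_setLIntegral_le_of_sigmaFinite (Measure.measurable_rnDeriv _ _)
    fun s hs _ => ?_
  rw [setLIntegral_const]
  exact (Measure.setLIntegral_rnDeriv_le s).trans (h s)

variable (E) in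
/-- The `L²` bound for the smooth singular integrals, for measures of bounded density. -/
theorem exists_lintegral_enorm_fderiv_sq_le : ∃ c : ℝ≥0, ∀ (A : ℝ≥0) (k : E → ℝ),
    HasKernelBound A k → ContDiff ℝ 2 k → HasCompactSupport k → ∀ e : E, ‖e‖ ≤ 1 →
      ∀ (γ : Measure E) [IsFiniteMeasure γ] (m : ℝ≥0), γ ≤ m • volume →
        ∫⁻ x, ‖∫ y, fderiv ℝ k (x - y) e ∂γ‖ₑ ^ 2 ≤ (c * A) ^ 2 * m * γ univ := by
  obtain ⟨c, hc0, hc⟩ := exists_norm_fourier_fderiv_le E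
  lift c to ℝ≥0 using hc0
  refine ⟨c, fun A k hk hk2 hks e he γ _ m hγ => ?_⟩
  set H : E → ℂ := fun x => (fderiv ℝ k x e : ℂ) with hH
  have hkc2 : ContDiff ℝ 2 fun x => (k x : ℂ) := Complex.ofRealCLM.contDiff.comp hk2
  have hkcs : HasCompactSupport fun x => (k x : ℂ) := hks.comp_left (g := fun r : ℝ => (r : ℂ)) rfl
  have hDint : Integrable (fderiv ℝ fun x => (k x : ℂ)) :=
    (hkc2.continuous_fderiv (by norm_num)).integrable_of_hasCompactSupport (hkcs.fderiv ℝ)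
  have hHe : H = fun x => (fderiv ℝ fun x => (k x : ℂ)) x e := by
    ext x
    have : (fun x => (k x : ℂ)) = Complex.ofRealCLM ∘ k := rfl
    rw [this, fderiv_comp x Complex.ofRealCLM.differentiableAt (hk2.differentiable (by norm_num) x)]
    simp [hH]
  have hHcont : Continuous H :=
    Complex.continuous_ofReal.comp ((hk2.continuous_fderiv (by norm_num)).clm_apply continuous_const)
  have hHsupp : HasCompactSupport H := by
    rw [hHe]
    exact (hkcs.fderiv ℝ).comp_left (g := fun L : E →L[ℝ] ℂ => L e) rfl
  have hHint : Integrable H := hHcont.integrable_of_hasCompactSupport hHsupp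
  obtain ⟨M, hM⟩ := hHsupp.exists_bound_of_continuous hHcont
  have hF : ∀ᵐ ξ : E, ‖𝓕 H ξ‖ ≤ (c * A : ℝ≥0) := by
    filter_upwards [compl_mem_ae_iff.2 (measure_singleton (μ := volume) (0 : E))] with ξ hξ
    rw [hHe]
    have : 𝓕 (fun x => (fderiv ℝ fun x => (k x : ℂ)) x e) ξ =
        𝓕 (fderiv ℝ fun x => (k x : ℂ)) ξ e :=
      (Real.fourier_continuousLinearMap_apply hDint).symm
    rw [this]
    calc _ ≤ ‖𝓕 (fderiv ℝ fun x => (k x : ℂ)) ξ‖ * ‖e‖ := ContinuousLinearMap.le_opNorm _ _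
      _ ≤ ‖𝓕 (fderiv ℝ fun x => (k x : ℂ)) ξ‖ * 1 := by gcongr
      _ ≤ _ := by rw [mul_one]; exact hc A k hk hk2 hks ξ hξ
  set g : E → ℂ := fun x => ((γ.rnDeriv volume x).toReal : ℂ) with hg
  have hac : γ ≪ volume := (Measure.absolutelyContinuous_of_le hγ).trans
    Measure.smul_absolutelyContinuous
  have hgint : Integrable g := Measure.integrable_toReal_rnDeriv.ofReal
  have hgm : ∀ᵐ x, ‖g x‖ ≤ m := by
    filter_upwards [ae_rnDeriv_le_of_le_smul hγ] with x hx
    rw [hg, Complex.norm_real, Real.norm_of_nonneg ENNReal.toReal_nonneg]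
    exact ENNReal.toReal_le_of_le_ofReal m.2 (by simpa using hx)
  have hg2 := memLp_two_of_integrable_of_bound hgint hgm
  have key := eLpNorm_convolution_le_of_norm_fourier_le hgint hg2 hHint hM hF
  have hconv : ∀ x, ∫ y, g y * H (x - y) = ((∫ y, fderiv ℝ k (x - y) e ∂γ : ℝ) : ℂ) := by
    intro x
    rw [← integral_rnDeriv_smul hac, ← integral_complex_ofReal]
    simp [hg, hH]
  simp only [hconv] at key
  have sq : ∀ f : E → ℂ, eLpNorm f 2 ^ 2 = ∫⁻ x, ‖f x‖ₑ ^ 2 := fun f => by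
    rw [eLpNorm_eq_lintegral_rpow_enorm_toReal (by norm_num) (by norm_num), ← ENNReal.rpow_natCast,
      ← ENNReal.rpow_mul]
    simp
  -- The density is at most m, so its square is at most m times itself.
  have hgsq : ∫⁻ x, ‖g x‖ₑ ^ 2 ≤ m * γ univ := by
    rw [← Measure.lintegral_rnDeriv hac, ← lintegral_const_mul _ (Measure.measurable_rnDeriv _ _)]
    refine lintegral_mono_ae ?_
    filter_upwards [ae_rnDeriv_le_of_le_smul hγ] with x hx
    have : ‖g x‖ₑ ≤ γ.rnDeriv volume x := by
      rw [hg, ← ofReal_norm, Complex.norm_real, Real.norm_of_nonneg ENNReal.toReal_nonneg]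
      exact ENNReal.ofReal_toReal_le
    rw [pow_two]
    exact mul_le_mul' (this.trans hx) this
  have hpow := pow_le_pow_left' key 2
  rw [mul_pow, sq, sq] at hpow
  have hen : ∀ x, ‖((∫ y, fderiv ℝ k (x - y) e ∂γ : ℝ) : ℂ)‖ₑ = ‖∫ y, fderiv ℝ k (x - y) e ∂γ‖ₑ :=
    fun x => by rw [← ofReal_norm, Complex.norm_real, ofReal_norm]
  simp only [hen] at hpow
  refine hpow.trans ?_
  rw [mul_assoc]
  push_cast
  gcongr

end Multiplier


/-! ### Cotlar-type estimate: the maximal operator on measures of bounded density -/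

section Cotlar

lemma ENNReal.sq_le_nine_mul {a x y z : ℝ≥0∞} (h : a ≤ x + y + z) :
    a ^ 2 ≤ 9 * (x ^ 2 + y ^ 2 + z ^ 2) := by
  set w := max x (max y z) with hw
  have h1 : a ≤ 3 * w := by
    calc a ≤ x + y + z := h
      _ ≤ w + w + w := by
        gcongr
        · exact le_max_left _ _
        · exact (le_max_left _ _).trans (le_max_right _ _)
        · exact (le_max_right _ _).trans (le_max_right _ _)
      _ = 3 * w := by ring
  have h2 : w ^ 2 ≤ x ^ 2 + y ^ 2 + z ^ 2 := by
    rcases max_choice x (max y z) with hx | hx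
    · rw [hw, hx, add_assoc]; exact le_self_add
    · rcases max_choice y z with hy | hy
      · rw [hw, hx, hy, add_right_comm]; exact le_add_self
      · rw [hw, hx, hy]; exact le_add_self
  calc a ^ 2 ≤ (3 * w) ^ 2 := by gcongr
    _ = 9 * w ^ 2 := by ring
    _ ≤ _ := by gcongr

variable {E : Type*} [NormedAddCommGroup E] [InnerProductSpace ℝ E] [MeasurableSpace E]

/-- The convolution of a measure with the derivative of `k` in the direction `e`. -/
noncomputable def derivPotential (k : E → ℝ) (e : E) (ν : Measure E) (x : E) : ℝ :=
  ∫ y, fderiv ℝ k (x - y) e ∂ν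

variable [BorelSpace E]

lemma integrable_fderiv_sub [SecondCountableTopology E] {k : E → ℝ} (hk : ContDiff ℝ 2 k) {M : ℝ}
    (hM : ∀ x, ‖fderiv ℝ k x‖ ≤ M) (e : E) (ν : Measure E) [IsFiniteMeasure ν] (x : E) :
    Integrable (fun y => fderiv ℝ k (x - y) e) ν := by
  refine (integrable_const (M * ‖e‖)).mono' ?_ (Eventually.of_forall fun y => ?_)
  · exact (((hk.continuous_fderiv (by norm_num)).comp (continuous_const.sub continuous_id)).clm_apply
      continuous_const).aestronglyMeasurable
  · exact ((fderiv ℝ k (x - y)).le_opNorm e).trans (by gcongr; exact hM _)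

variable [FiniteDimensional ℝ E]

lemma continuous_derivPotential {k : E → ℝ} (hk : ContDiff ℝ 2 k) {M : ℝ}
    (hM : ∀ x, ‖fderiv ℝ k x‖ ≤ M) (e : E) (ν : Measure E) [IsFiniteMeasure ν] :
    Continuous (derivPotential k e ν) := by
  refine continuous_of_dominated (bound := fun _ => M * ‖e‖)
    (fun x => (integrable_fderiv_sub hk hM e ν x).aestronglyMeasurable)
    (fun x => Eventually.of_forall fun y => ?_) (integrable_const _)
    (Eventually.of_forall fun y => ?_)
  · exact ((fderiv ℝ k (x - y)).le_opNorm e).trans (by gcongr; exact hM _)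
  · exact ((hk.continuous_fderiv (by norm_num)).comp (continuous_id.sub continuous_const)).clm_apply
      continuous_const

variable [Nontrivial E]

lemma hasGrowthAt_of_le_smul_volume {γ : Measure E} {m : ℝ≥0} (hγ : γ ≤ m • volume) (x : E) :
    HasGrowthAt γ (m * (volume (ball (0 : E) 1)).toReal) x := fun r hr => by
  calc γ (ball x r) ≤ m * volume (ball x r) := hγ _
    _ ≤ m * ENNReal.ofReal ((volume (ball (0 : E) 1)).toReal * r ^ finrank ℝ E) := by
        gcongr; exact hasGrowthAt_addHaar volume x r hr
    _ = _ := by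
        rw [mul_assoc, ENNReal.ofReal_mul (p := (m : ℝ)) m.2, ENNReal.ofReal_coe_nnreal]

/-- The smooth truncations at scale `ε` vary little at scale `ε`. -/
lemma enorm_derivPotential_sub_le {k : E → ℝ} {B ε D : ℝ} (hk : HasKernelBound B k)
    (hk2 : ContDiff ℝ 2 k) (hε : 0 < ε) (h0 : ∀ x ∈ ball (0 : E) ε, k x = 0) {e : E}
    (he : ‖e‖ ≤ 1) {γ : Measure E} [IsFiniteMeasure γ] {x z : E} (hD : 0 ≤ D)
    (hγ : HasGrowthAt γ D x) (hz : z ∈ ball x ε) :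
    ‖derivPotential k e γ x - derivPotential k e γ z‖ₑ ≤
      ENNReal.ofReal ((2 ^ finrank ℝ E + 4 ^ finrank ℝ E * 2) * B * D) := by
  have hB := hk.nonneg
  have hM := hk.norm_fderiv_le_of_eq_zero hε h0
  set d := finrank ℝ E with hd
  set F : E → ℝ := fun y => fderiv ℝ k (x - y) e - fderiv ℝ k (z - y) e with hF
  have hzx : ‖z - x‖ ≤ ε := by rw [← dist_eq_norm]; exact (mem_ball.1 hz).le
  have hFle : ∀ y, ‖F y‖ ≤ ‖fderiv ℝ k (z - y) - fderiv ℝ k (x - y)‖ := fun y => by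
    rw [hF, norm_sub_rev]
    calc _ = ‖(fderiv ℝ k (z - y) - fderiv ℝ k (x - y)) e‖ := by simp
      _ ≤ ‖fderiv ℝ k (z - y) - fderiv ℝ k (x - y)‖ * ‖e‖ := ContinuousLinearMap.le_opNorm _ _
      _ ≤ _ := mul_le_of_le_one_right (norm_nonneg _) he
  have e1 : derivPotential k e γ x - derivPotential k e γ z = ∫ y, F y ∂γ :=
    (integral_sub (integrable_fderiv_sub hk2 hM e γ x) (integrable_fderiv_sub hk2 hM e γ z)).symm
  rw [e1]
  refine (enorm_integral_le_lintegral_enorm _).trans ?_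
  rw [← lintegral_add_compl _ (measurableSet_ball (x := x) (ε := 2 * ε))]
  have h1 : ∫⁻ y in ball x (2 * ε), ‖F y‖ₑ ∂γ ≤
      ENNReal.ofReal (B / ε ^ (d + 1) * ε * (D * (2 * ε) ^ d)) := by
    refine setLIntegral_enorm_le_of_norm_le measurableSet_ball (by positivity) (fun y _ => ?_)
      (hγ _ (by positivity))
    refine ((hFle y).trans (hk.norm_fderiv_sub_le_of_eq_zero hk2 hε h0 (x - y) (z - y))).trans ?_
    rw [sub_sub_sub_cancel_right]
    gcongr
  have h2 : ∫⁻ y in (ball x (2 * ε))ᶜ, ‖F y‖ₑ ∂γ ≤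
      ENNReal.ofReal (2 ^ (d + 1) * (2 ^ (d + 1) * B * ε) * D / (2 * ε)) := by
    refine hγ.lintegral_compl_ball_le hD (by positivity) (by positivity) fun y hy => ?_
    have hxy : 2 * ε ≤ ‖x - y‖ := by rwa [norm_sub_rev]
    have := hk.norm_fderiv_sub_le (u := x - y) (v := z - y)
      (norm_pos_iff.1 (by linarith)) (by rw [sub_sub_sub_cancel_right]; linarith)
    refine ((hFle y).trans this).trans ?_
    rw [sub_sub_sub_cancel_right, norm_sub_rev x y]
    calc _ ≤ 2 ^ (d + 1) * B / ‖y - x‖ ^ (d + 1) * ε := by gcongr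
      _ = _ := by ring
  refine (add_le_add h1 h2).trans ?_
  rw [← ENNReal.ofReal_add (by positivity) (by positivity)]
  refine ENNReal.ofReal_le_ofReal (le_of_eq ?_)
  have : (4 : ℝ) ^ d = 2 ^ d * 2 ^ d := by rw [← mul_pow]; norm_num
  rw [this, pow_succ, pow_succ, mul_pow]
  field_simp

/-- Both cutoffs agree with k outside the ball of radius 2ε, so only points y within 3ε of x
contribute. The difference of two truncations thus becomes the potential of a localized measure, to
which the L² bound applies with mass O(m |B(x, ε)|). -/
lemma derivPotential_cutoff_sub {k : E → ℝ} {A B : ℝ} (hk : HasKernelBound A k) {δ ε : ℝ}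
    (hδ : 0 < δ) (hδε : δ ≤ ε) (hkδ : HasKernelBound B (cutoff δ k))
    (hkε : HasKernelBound B (cutoff ε k)) (e : E) (γ : Measure E) [IsFiniteMeasure γ] {x z : E}
    (hz : z ∈ ball x ε) :
    derivPotential (cutoff δ k) e γ z - derivPotential (cutoff ε k) e γ z =
      derivPotential (fun w => cutoff δ k w - cutoff ε k w) e (γ.restrict (ball x (4 * ε))) z := by
  have hε : 0 < ε := hδ.trans_le hδε
  have h2δ := contDiff_cutoff hδ hk.1
  have h2ε := contDiff_cutoff hε hk.1
  have hMδ := hkδ.norm_fderiv_le_of_eq_zero hδ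
    (fun x hx => cutoff_eq_zero hδ k (by simpa using (mem_ball.1 hx).le))
  have hMε := hkε.norm_fderiv_le_of_eq_zero hε
    (fun x hx => cutoff_eq_zero hε k (by simpa using (mem_ball.1 hx).le))
  rw [derivPotential, derivPotential, derivPotential,
    ← integral_sub (integrable_fderiv_sub h2δ hMδ e γ z) (integrable_fderiv_sub h2ε hMε e γ z),
    setIntegral_eq_integral_of_forall_compl_eq_zero]
  · refine integral_congr_ae (Eventually.of_forall fun y => ?_)
    simp only
    rw [fderiv_fun_sub (h2δ.differentiable (by norm_num) _) (h2ε.differentiable (by norm_num) _)]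
    rfl
  · intro y hy
    have h1 : 4 * ε ≤ dist y x := by simpa using hy
    have h2 : dist z x < ε := hz
    have h3 : 2 * ε < ‖z - y‖ := by
      rw [← dist_eq_norm, dist_comm z y]
      linarith [dist_triangle y z x]
    have : (fun w => cutoff δ k w - cutoff ε k w) =ᶠ[𝓝 (z - y)] fun _ => 0 := by
      filter_upwards [(isOpen_lt continuous_const continuous_norm).mem_nhds h3] with w hw
      have hw : 2 * ε < ‖w‖ := hw
      rw [cutoff_eq hδ k (by linarith), cutoff_eq hε k hw.le, sub_self]
    rw [this.fderiv_eq]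
    simp

/-- The maximal smooth singular integral of a measure with bounded density is of weak type. -/
theorem exists_mul_volume_cutoff_le_of_le_smul_volume (A : ℝ≥0) : ∃ Λ C : ℝ≥0, ∀ k : E → ℝ,
    HasKernelBound A k → HasCompactSupport k → ∀ e : E, ‖e‖ ≤ 1 →
      ∀ (γ : Measure E) [IsFiniteMeasure γ] (m : ℝ≥0), 0 < m → γ ≤ m • volume →
        m * volume {x | ∃ ε : ℝ, 0 < ε ∧ (Λ * m : ℝ≥0) < ‖derivPotential (cutoff ε k) e γ x‖ₑ} ≤
          C * γ univ := by
  obtain ⟨c, hc1, hc⟩ := exists_hasKernelBound_cutoff E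
  obtain ⟨c₂, hc₂⟩ := exists_lintegral_enorm_fderiv_sq_le E
  lift c to ℝ≥0 using (zero_le_one.trans hc1)
  set d := finrank ℝ E with hd
  set v := (volume (ball (0 : E) 1)).toReal with hv
  have hv0 : 0 ≤ v := ENNReal.toReal_nonneg
  set B : ℝ≥0 := c * A with hB
  -- `C₁` measures the variation of the truncation at scale ε over a ball of radius ε, `C₂` the L²
  -- size of the localized difference. The 1 in `Λ` is for the truncation at scale δ, and 9 comes
  -- from squaring a sum of three terms.
  set C₁ : ℝ≥0 := (2 ^ d + 4 ^ d * 2) * B * v.toNNReal with hC₁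
  set C₂ : ℝ≥0 := (c₂ * (B + B)) ^ 2 * 4 ^ d with hC₂
  set Λ : ℝ≥0 := 9 * (C₁ ^ 2 + 1 + C₂) with hΛ
  have hΛ1 : 1 ≤ Λ := by
    rw [hΛ]
    have : (1 : ℝ≥0) ≤ C₁ ^ 2 + 1 + C₂ := by
      rw [add_right_comm]; exact le_add_self
    calc (1 : ℝ≥0) ≤ 9 * 1 := by norm_num
      _ ≤ _ := by gcongr
  refine ⟨Λ, 4 ^ d * (c₂ * B) ^ 2, fun k hk hks e he γ _ m hm hγ => ?_⟩
  have hcut : ∀ ε, HasKernelBound B (cutoff ε k) := fun ε => by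
    simpa [hB] using hc A k hk A.2 ε
  have hcut0 : ∀ ε, 0 < ε → ∀ x ∈ ball (0 : E) ε, cutoff ε k x = 0 := fun ε hε x hx =>
    cutoff_eq_zero hε k (by simpa using (mem_ball.1 hx).le)
  have hm0 : (m : ℝ≥0∞) ≠ 0 := by exact_mod_cast hm.ne'
  have main : ∀ δ : ℝ, 0 < δ → m * volume {x | ∃ ε : ℝ, δ ≤ ε ∧
      (Λ * m : ℝ≥0) < ‖derivPotential (cutoff ε k) e γ x‖ₑ} ≤
        (4 ^ d * (c₂ * B) ^ 2 : ℝ≥0) * γ univ := by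
    intro δ hδ
    have h2δ := contDiff_cutoff hδ hk.1
    have hTc : Continuous (derivPotential (cutoff δ k) e γ) := continuous_derivPotential h2δ
      ((hcut δ).norm_fderiv_le_of_eq_zero hδ (hcut0 δ hδ)) e γ
    -- The square of the truncation at the smallest scale δ is the density of a finite measure, by
    -- the L² bound. Off the level set of its maximal function at height m², averaging over B(x, ε)
    -- bounds every truncation at scale ε ≥ δ by Λm.
    set ρ : Measure E := volume.withDensity fun z => ‖derivPotential (cutoff δ k) e γ z‖ₑ ^ 2 with hρ
    have hρu : ρ univ ≤ (c₂ * B) ^ 2 * m * γ univ := by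
      rw [hρ, withDensity_apply _ MeasurableSet.univ, Measure.restrict_univ]
      exact hc₂ B _ (hcut δ) h2δ (hasCompactSupport_cutoff hks δ) e he γ m hγ
    have : IsFiniteMeasure ρ := ⟨hρu.trans_lt (ENNReal.mul_lt_top (ENNReal.mul_lt_top
      (ENNReal.pow_lt_top (ENNReal.mul_lt_top ENNReal.coe_lt_top ENNReal.coe_lt_top))
      ENNReal.coe_lt_top) (measure_lt_top _ _))⟩
    have hsub : {x | ∃ ε : ℝ, δ ≤ ε ∧ (Λ * m : ℝ≥0) < ‖derivPotential (cutoff ε k) e γ x‖ₑ} ⊆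
        maximalLevelSet ρ (m ^ 2) := by
      rintro x ⟨ε, hδε, hx⟩
      by_contra hxM
      refine hx.not_ge ?_
      have hε : 0 < ε := hδ.trans_le hδε
      set a := ‖derivPotential (cutoff ε k) e γ x‖ₑ with ha
      set S := derivPotential (fun w => cutoff δ k w - cutoff ε k w) e
        (γ.restrict (ball x (4 * ε))) with hS
      have h2ε := contDiff_cutoff hε hk.1
      have hpt : ∀ z ∈ ball x ε, a ≤ (C₁ * m : ℝ≥0) +
          ‖derivPotential (cutoff δ k) e γ z‖ₑ + ‖S z‖ₑ := by
        intro z hz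
        have h1 := enorm_derivPotential_sub_le (hcut ε) h2ε hε (hcut0 ε hε) he (by positivity)
          (hasGrowthAt_of_le_smul_volume hγ x) hz
        have h2 : ENNReal.ofReal ((2 ^ finrank ℝ E + 4 ^ finrank ℝ E * 2) * B *
            (m * (volume (ball (0 : E) 1)).toReal)) = (C₁ * m : ℝ≥0) := by
          rw [← ENNReal.ofReal_coe_nnreal]
          congr 1
          rw [hC₁]
          push_cast
          rw [Real.coe_toNNReal _ hv0]
          ring
        rw [h2] at h1
        have h3 := derivPotential_cutoff_sub hk hδ hδε (hcut δ) (hcut ε) e γ hz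
        have h4 : derivPotential (cutoff ε k) e γ x =
            (derivPotential (cutoff ε k) e γ x - derivPotential (cutoff ε k) e γ z) +
              derivPotential (cutoff δ k) e γ z - S z := by rw [hS, ← h3]; ring
        rw [ha, h4]
        refine enorm_sub_le.trans (add_le_add_left ((enorm_add_le _ _).trans ?_) _)
        exact add_le_add_left h1 _
      set V := volume (ball x ε) with hV
      have hV0 : V ≠ 0 := (measure_ball_pos _ _ hε).ne'
      have hVt : V ≠ ∞ := measure_ball_lt_top.ne
      have hSint : ∫⁻ z in ball x ε, ‖S z‖ₑ ^ 2 ≤ C₂ * m ^ 2 * V := by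
        have h4 : γ.restrict (ball x (4 * ε)) univ ≤ m * (4 ^ d * V) := by
          rw [Measure.restrict_apply_univ]
          refine (hγ _).trans_eq ?_
          rw [Measure.smul_apply, ENNReal.smul_def, smul_eq_mul,
            volume_ball_const_mul x x (by norm_num), ENNReal.ofReal_pow (by norm_num),
            ENNReal.ofReal_ofNat]
        have hsub : HasKernelBound ((B + B : ℝ≥0) : ℝ) fun w => cutoff δ k w - cutoff ε k w := by
          push_cast
          exact (hcut δ).sub (hcut ε)
        calc ∫⁻ z in ball x ε, ‖S z‖ₑ ^ 2 ≤ ∫⁻ z, ‖S z‖ₑ ^ 2 := setLIntegral_le_lintegral _ _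
          _ ≤ (c₂ * (B + B : ℝ≥0)) ^ 2 * m * γ.restrict (ball x (4 * ε)) univ :=
              hc₂ (B + B) _ hsub (h2δ.sub h2ε)
                ((hasCompactSupport_cutoff hks δ).sub (hasCompactSupport_cutoff hks ε)) e he _ m
                (Measure.restrict_le_self.trans hγ)
          _ ≤ (c₂ * (B + B : ℝ≥0)) ^ 2 * m * (m * (4 ^ d * V)) := by gcongr
          _ = _ := by rw [hC₂]; push_cast; ring
      have hTint : ∫⁻ z in ball x ε, ‖derivPotential (cutoff δ k) e γ z‖ₑ ^ 2 ≤ m ^ 2 * V := by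
        have := measure_ball_le_of_notMem_maximalLevelSet hxM hε
        rwa [hρ, withDensity_apply _ measurableSet_ball] at this
      have hfin : V * a ^ 2 ≤ V * (Λ * m ^ 2 : ℝ≥0) := by
        calc V * a ^ 2 = ∫⁻ _ in ball x ε, a ^ 2 := by rw [setLIntegral_const, mul_comm]
          _ ≤ ∫⁻ z in ball x ε, 9 * (((C₁ * m : ℝ≥0) : ℝ≥0∞) ^ 2 +
                ‖derivPotential (cutoff δ k) e γ z‖ₑ ^ 2 + ‖S z‖ₑ ^ 2) :=
              setLIntegral_mono' measurableSet_ball fun z hz => ENNReal.sq_le_nine_mul (hpt z hz)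
          _ = 9 * (((C₁ * m : ℝ≥0) : ℝ≥0∞) ^ 2 * V +
                (∫⁻ z in ball x ε, ‖derivPotential (cutoff δ k) e γ z‖ₑ ^ 2) +
                ∫⁻ z in ball x ε, ‖S z‖ₑ ^ 2) := by
              have hmeas : Measurable fun z => ‖derivPotential (cutoff δ k) e γ z‖ₑ ^ 2 :=
                (hTc.measurable.enorm).pow_const 2
              rw [lintegral_const_mul' _ _ (by norm_num),
                lintegral_add_left (f := fun z => ((C₁ * m : ℝ≥0) : ℝ≥0∞) ^ 2 +
                  ‖derivPotential (cutoff δ k) e γ z‖ₑ ^ 2) (measurable_const.add hmeas),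
                lintegral_add_left measurable_const,
                setLIntegral_const]
          _ ≤ 9 * (((C₁ * m : ℝ≥0) : ℝ≥0∞) ^ 2 * V + m ^ 2 * V + C₂ * m ^ 2 * V) := by gcongr
          _ = _ := by rw [hΛ]; push_cast; ring
      have h5 : a ^ 2 ≤ (Λ * m ^ 2 : ℝ≥0) := (ENNReal.mul_le_mul_iff_right hV0 hVt).1 hfin
      have h6 : a ^ 2 ≤ ((Λ * m : ℝ≥0) : ℝ≥0∞) ^ 2 := by
        refine h5.trans ?_
        rw [← ENNReal.coe_pow, ENNReal.coe_le_coe, mul_pow]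
        gcongr
        exact le_self_pow₀ hΛ1 (by norm_num)
      exact (ENNReal.pow_le_pow_left_iff two_ne_zero).1 h6
    have hw := mul_volume_maximalLevelSet_le ρ (t := m ^ 2) (pow_ne_zero 2 hm0)
    -- The level is m² and the mass of ρ is O(m γ(E)), so one factor m cancels.
    have h7 : m * (m * volume {x | ∃ ε : ℝ, δ ≤ ε ∧
        (Λ * m : ℝ≥0) < ‖derivPotential (cutoff ε k) e γ x‖ₑ}) ≤
          m * ((4 ^ d * (c₂ * B) ^ 2 : ℝ≥0) * γ univ) := by
      rw [← mul_assoc, ← pow_two]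
      calc _ ≤ (m : ℝ≥0∞) ^ 2 * volume (maximalLevelSet ρ (m ^ 2)) := by gcongr
        _ ≤ 4 ^ d * ρ univ := hw
        _ ≤ 4 ^ d * ((c₂ * B) ^ 2 * m * γ univ) := by gcongr
        _ = _ := by push_cast; ring
    exact (ENNReal.mul_le_mul_iff_right hm0 ENNReal.coe_ne_top).1 h7
  -- The bound is uniform in δ and the sets increase as δ decreases to 0, so it passes to all ε > 0.
  set S : ℕ → Set E := fun n => {x | ∃ ε : ℝ, 1 / ((n : ℝ) + 1) ≤ ε ∧
    (Λ * m : ℝ≥0) < ‖derivPotential (cutoff ε k) e γ x‖ₑ} with hS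
  have hSmono : Monotone S := fun i j hij x ⟨ε, hε, hx⟩ => ⟨ε, le_trans (by gcongr) hε, hx⟩
  have hSU : {x | ∃ ε : ℝ, 0 < ε ∧ (Λ * m : ℝ≥0) < ‖derivPotential (cutoff ε k) e γ x‖ₑ} ⊆
      ⋃ n, S n := by
    rintro x ⟨ε, hε, hx⟩
    obtain ⟨n, hn⟩ := exists_nat_one_div_lt hε
    exact mem_iUnion.2 ⟨n, ε, hn.le, hx⟩
  calc _ ≤ m * volume (⋃ n, S n) := by gcongr
    _ = ⨆ n, m * volume (S n) := by rw [hSmono.measure_iUnion, ENNReal.mul_iSup]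
    _ ≤ _ := iSup_le fun n => main _ (by positivity)

end Cotlar


/-! ### Weak type (1, 1) of the maximal smooth singular integral -/

section WeakType

variable {E : Type*} [NormedAddCommGroup E] [InnerProductSpace ℝ E] [FiniteDimensional ℝ E]
  [MeasurableSpace E] [BorelSpace E] [Nontrivial E]

/-- Chebyshev's inequality off U, integrating term by term: each tail is integrated outside the ball
of radius 2 s y, where the factor s y cancels. This handles the bad part of the Calderón–Zygmund
decomposition. -/
lemma mul_volume_ge_inter_le_of_tsum {U u : Set E} {s : E → ℝ} {w : E → ℝ≥0∞} {B : ℝ} (hB : 0 ≤ B)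
    (hu : u.Countable) (hs : ∀ y ∈ u, 0 < s y)
    (hsU : ∀ y ∈ u, ball y (2 * s y) ⊆ U) (t : ℝ≥0∞) :
    t * volume ({x | t ≤ ∑' y : u, 2 * w y * ENNReal.ofReal (B * s y / ‖x - (y : E)‖ ^ (finrank ℝ E + 1))} ∩
      Uᶜ) ≤ ENNReal.ofReal (2 ^ (finrank ℝ E + 1) * B * (volume (ball (0 : E) 1)).toReal) *
        ∑' y : u, w y := by
  have : Countable u := hu.to_subtype
  set v := (volume (ball (0 : E) 1)).toReal with hv
  have hv0 : 0 ≤ v := ENNReal.toReal_nonneg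
  have hf : ∀ y : u, Measurable fun x : E =>
      ENNReal.ofReal (B * s y / ‖x - (y : E)‖ ^ (finrank ℝ E + 1)) := fun y => by
    have : Measurable fun x : E => ‖x - (y : E)‖ := (measurable_id.sub_const _).norm
    exact ENNReal.measurable_ofReal.comp ((this.pow_const _).const_div _)
  have hG : Measurable fun x : E =>
      ∑' y : u, 2 * w y * ENNReal.ofReal (B * s y / ‖x - (y : E)‖ ^ (finrank ℝ E + 1)) :=
    Measurable.tsum fun y => (hf y).const_mul _
  rw [← Measure.restrict_apply (measurableSet_le measurable_const hG)]
  refine (mul_meas_ge_le_lintegral hG t).trans ?_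
  rw [lintegral_tsum fun y => ((hf y).const_mul _).aemeasurable, ← ENNReal.tsum_mul_left]
  refine ENNReal.tsum_le_tsum fun y => ?_
  rw [lintegral_const_mul _ (hf y)]
  have hsy := hs y y.2
  have h1 : ∫⁻ x in Uᶜ, ENNReal.ofReal (B * s y / ‖x - y‖ ^ (finrank ℝ E + 1)) ≤
      ENNReal.ofReal (2 ^ (finrank ℝ E + 1) * (B * s y) * v / (2 * s y)) := by
    refine (lintegral_mono_set (compl_subset_compl.2 (hsU y y.2))).trans ?_
    have := (hasGrowthAt_addHaar volume (y : E)).lintegral_compl_ball_le hv0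
      (f := fun x : E => B * s y / ‖x - y‖ ^ (finrank ℝ E + 1)) (A := B * s y) (r := 2 * s y)
      (by positivity) (by positivity) fun x _ => by rw [Real.norm_of_nonneg (by positivity)]
    refine le_trans (le_of_eq (lintegral_congr fun x => ?_)) this
    rw [Real.enorm_of_nonneg (by positivity)]
  calc 2 * w y * _ ≤ 2 * w y * ENNReal.ofReal (2 ^ (finrank ℝ E + 1) * (B * s y) * v / (2 * s y)) := by
        gcongr
    _ = ENNReal.ofReal (2 * (2 ^ (finrank ℝ E + 1) * (B * s y) * v / (2 * s y))) * w y := by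
        rw [ENNReal.ofReal_mul (by norm_num), ENNReal.ofReal_ofNat]; ring
    _ = _ := by congr 2; field_simp

/-- The maximal smooth singular integral with a compactly supported kernel is of weak type
`(1, 1)`. -/
theorem exists_mul_volume_cutoff_le_of_hasCompactSupport (A : ℝ≥0) : ∃ C : ℝ≥0, ∀ k : E → ℝ,
    HasKernelBound A k → HasCompactSupport k → ∀ e : E, ‖e‖ ≤ 1 →
      ∀ (ν : Measure E) [IsFiniteMeasure ν] (t : ℝ≥0),
        t * volume {x | ∃ ε : ℝ, 0 < ε ∧ t < ‖derivPotential (cutoff ε k) e ν x‖ₑ} ≤ C * ν univ := by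
  obtain ⟨c, hc1, hc⟩ := exists_hasKernelBound_cutoff E
  lift c to ℝ≥0 using (zero_le_one.trans hc1)
  obtain ⟨Λ₀, C₀, h₀⟩ := exists_mul_volume_cutoff_le_of_le_smul_volume (E := E) A
  set d := finrank ℝ E with hd
  set v := (volume (ball (0 : E) 1)).toReal with hv
  set B : ℝ≥0 := c * A with hB
  -- The threshold T = Λt is shared out: t for the oscillation terms and Λ₀ · 44^d t for the good
  -- part, whose density is at most 44^d t.
  set Λ : ℝ≥0 := 1 + Λ₀ * 44 ^ d with hΛ
  set C₁ : ℝ≥0 := (2 ^ (d + 1) * (2 ^ (d + 1) * (B : ℝ)) * v).toNNReal with hC₁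
  set C : ℝ≥0 := 4 ^ d + C₁ + C₀ with hC
  have hΛ0 : Λ ≠ 0 := by rw [hΛ]; positivity
  refine ⟨Λ * C, fun k hk hks e he ν _ T => ?_⟩
  rcases eq_or_ne T 0 with rfl | hT
  · simp
  set t : ℝ≥0 := T / Λ with ht
  have htΛ : T = Λ * t := by rw [ht, mul_div_cancel₀ _ hΛ0]
  have ht0 : 0 < t := pos_iff_ne_zero.2 (div_ne_zero hT hΛ0)
  have hcut : ∀ ε, HasKernelBound B (cutoff ε k) := fun ε => by
    simpa [hB] using hc A k hk A.2 ε
  have hcut0 : ∀ ε, 0 < ε → ∀ x ∈ ball (0 : E) ε, cutoff ε k x = 0 := fun ε hε x hx =>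
    cutoff_eq_zero hε k (by simpa using (mem_ball.1 hx).le)
  obtain ⟨U, γ, u, s, w, -, hvolU, hγu, hγ, hu, hs, hsU, hw, hdiff⟩ :=
    exists_calderonZygmund_decomposition ν ht0
  have : IsFiniteMeasure γ := ⟨by rw [hγu]; exact measure_lt_top _ _⟩
  set m : ℝ≥0 := 44 ^ d * t with hm
  have htm : t ≤ m := by
    rw [hm]; exact le_mul_of_one_le_left t.2 (one_le_pow₀ (by norm_num))
  have hgood := h₀ k hk hks e he γ m (by positivity) hγ
  -- A majorant of the bad part free of ε: the cutoffs satisfy the kernel bounds with one constant,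
  -- so `G` controls all truncations at once.
  set G : E → ℝ≥0∞ := fun x =>
    ∑' y : u, 2 * w y * ENNReal.ofReal (2 ^ (d + 1) * B * s y / ‖x - (y : E)‖ ^ (d + 1)) with hG
  have hbad := mul_volume_ge_inter_le_of_tsum (w := w) (B := 2 ^ (d + 1) * B) (by positivity) hu hs hsU t
  have hsub : {x | ∃ ε : ℝ, 0 < ε ∧ T < ‖derivPotential (cutoff ε k) e ν x‖ₑ} ⊆
      U ∪ ({x | t ≤ G x} ∩ Uᶜ) ∪
        {x | ∃ ε : ℝ, 0 < ε ∧ (Λ₀ * m : ℝ≥0) < ‖derivPotential (cutoff ε k) e γ x‖ₑ} := by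
    rintro x ⟨ε, hε, hx⟩
    by_contra hcon
    simp only [mem_union, mem_inter_iff, mem_ofPred_eq, mem_compl_iff, not_or, not_and, not_not,
      not_exists, not_lt] at hcon
    obtain ⟨⟨hxU, hxG⟩, hxγ⟩ := hcon
    have hxG : G x < t := by
      by_contra hcon
      exact hxU (hxG (not_lt.1 hcon))
    have h2ε := contDiff_cutoff hε hk.1
    have hM := (hcut ε).norm_fderiv_le_of_eq_zero hε (hcut0 ε hε)
    have h1 : ‖derivPotential (cutoff ε k) e ν x - derivPotential (cutoff ε k) e γ x‖ₑ ≤ G x := by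
      refine hdiff (fun y => fderiv ℝ (cutoff ε k) (x - y) e) (integrable_fderiv_sub h2ε hM e ν x)
        (integrable_fderiv_sub h2ε hM e γ x)
        (fun y => ENNReal.ofReal (2 ^ (d + 1) * B * s y / ‖x - y‖ ^ (d + 1))) fun y hy z hz => ?_
      have hsy := hs y hy
      have hxy : 2 * s y ≤ ‖x - y‖ := by
        by_contra hcon
        exact hxU (hsU y hy (by rw [mem_ball, dist_eq_norm]; exact not_le.1 hcon))
      have hzy : ‖z - y‖ ≤ s y := by rw [← dist_eq_norm]; exact (mem_ball.1 hz).le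
      have h2 := (hcut ε).norm_fderiv_sub_le (u := x - y) (v := x - z)
        (norm_pos_iff.1 (by linarith)) (by
          rw [sub_sub_sub_cancel_left, norm_sub_rev]; linarith)
      rw [sub_sub_sub_cancel_left, norm_sub_rev y z] at h2
      rw [← ofReal_norm]
      refine ENNReal.ofReal_le_ofReal ?_
      calc _ = ‖(fderiv ℝ (cutoff ε k) (x - z) - fderiv ℝ (cutoff ε k) (x - y)) e‖ := by simp
        _ ≤ ‖fderiv ℝ (cutoff ε k) (x - z) - fderiv ℝ (cutoff ε k) (x - y)‖ * ‖e‖ :=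
            ContinuousLinearMap.le_opNorm _ _
        _ ≤ ‖fderiv ℝ (cutoff ε k) (x - z) - fderiv ℝ (cutoff ε k) (x - y)‖ :=
            mul_le_of_le_one_right (norm_nonneg _) he
        _ ≤ 2 ^ (d + 1) * B / ‖x - y‖ ^ (d + 1) * s y := h2.trans (by gcongr)
        _ = _ := by ring
    refine hx.not_ge ?_
    calc ‖derivPotential (cutoff ε k) e ν x‖ₑ
        = ‖(derivPotential (cutoff ε k) e ν x - derivPotential (cutoff ε k) e γ x) +
            derivPotential (cutoff ε k) e γ x‖ₑ := by rw [sub_add_cancel]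
      _ ≤ t + (Λ₀ * m : ℝ≥0) := (enorm_add_le _ _).trans (add_le_add (h1.trans hxG.le) (hxγ ε hε))
      _ = T := by rw [htΛ, hΛ, hm]; push_cast; ring
  have hC₁' : ENNReal.ofReal (2 ^ (d + 1) * (2 ^ (d + 1) * (B : ℝ)) * v) = C₁ := rfl
  rw [hC₁'] at hbad
  have key : t * volume {x | ∃ ε : ℝ, 0 < ε ∧ T < ‖derivPotential (cutoff ε k) e ν x‖ₑ} ≤
      C * ν univ := by
    calc _ ≤ t * (volume U + volume ({x | t ≤ G x} ∩ Uᶜ) + volume {x | ∃ ε : ℝ, 0 < ε ∧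
            (Λ₀ * m : ℝ≥0) < ‖derivPotential (cutoff ε k) e γ x‖ₑ}) := by
          refine mul_le_mul' le_rfl ((measure_mono hsub).trans ((measure_union_le _ _).trans ?_))
          exact add_le_add (measure_union_le _ _) le_rfl
      _ = t * volume U + t * volume ({x | t ≤ G x} ∩ Uᶜ) + t * volume {x | ∃ ε : ℝ, 0 < ε ∧
            (Λ₀ * m : ℝ≥0) < ‖derivPotential (cutoff ε k) e γ x‖ₑ} := by ring
      _ ≤ 4 ^ d * ν univ + C₁ * ν univ + C₀ * ν univ := by
          refine add_le_add (add_le_add hvolU (hbad.trans (by gcongr))) ?_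
          rw [← hγu]
          exact (mul_le_mul' (ENNReal.coe_le_coe.2 htm) le_rfl).trans hgood
      _ = _ := by rw [hC]; push_cast; ring
  calc (T : ℝ≥0∞) * _ = Λ * (t * volume {x | ∃ ε : ℝ, 0 < ε ∧
        T < ‖derivPotential (cutoff ε k) e ν x‖ₑ}) := by
        rw [← mul_assoc, ← ENNReal.coe_mul, ← htΛ]
    _ ≤ Λ * (C * ν univ) := mul_le_mul' le_rfl key
    _ = _ := by push_cast; ring

/-- The maximal smooth singular integral is of weak type `(1, 1)`. -/
theorem exists_mul_volume_cutoff_le (A : ℝ≥0) : ∃ C : ℝ≥0, ∀ k : E → ℝ,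
    HasKernelBound A k → ∀ e : E, ‖e‖ ≤ 1 →
      ∀ (ν : Measure E) [IsFiniteMeasure ν] (t : ℝ≥0),
        t * volume {x | ∃ ε : ℝ, 0 < ε ∧ t < ‖derivPotential (cutoff ε k) e ν x‖ₑ} ≤ C * ν univ := by
  obtain ⟨c, hc1, hc⟩ := exists_hasKernelBound_cutoff E
  lift c to ℝ≥0 using (zero_le_one.trans hc1)
  obtain ⟨C, hC⟩ := exists_mul_volume_cutoff_le_of_hasCompactSupport (E := E) (A + c * A)
  refine ⟨2 * C, fun k hk e he ν _ T => ?_⟩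
  rcases eq_or_ne T 0 with rfl | hT
  · simp
  set t : ℝ≥0 := T / 2 with ht
  have hTt : T = t + t := (add_halves T).symm
  have ht0 : 0 < t := by positivity
  set a : ℝ := c * (c * A) * (ν univ).toReal with ha
  have ha0 : 0 ≤ a := by positivity
  -- R depends on ν and T. It is so large that the part of the kernel beyond R contributes at most t
  -- = T/2 at every point. The remaining part has compact support and kernel bounds independent of
  -- R.
  set R : ℝ := max 1 (a / t) with hR
  have hR1 : 1 ≤ R := le_max_left _ _
  have hR0 : 0 < R := one_pos.trans_le hR1
  have haR : a / R ^ finrank ℝ E ≤ t := by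
    have h1 : a / t ≤ R ^ finrank ℝ E := (le_max_right _ _).trans (le_self_pow₀ hR1 finrank_pos.ne')
    rw [div_le_iff₀ (by positivity : (0 : ℝ) < t)] at h1
    rw [div_le_iff₀ (by positivity), mul_comm]
    exact h1
  set l : E → ℝ := fun x => k x - cutoff R k x with hl
  have hRk := hc A k hk A.2 R
  have hlK : HasKernelBound ((A + c * A : ℝ≥0) : ℝ) l := by
    push_cast
    exact hk.sub hRk
  have hls : HasCompactSupport l := by
    refine HasCompactSupport.intro (isCompact_closedBall (0 : E) (2 * R)) fun x hx => ?_
    have : 2 * R ≤ ‖x‖ := by simpa using (not_le.1 (mem_closedBall_zero_iff.not.1 hx)).le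
    simp [hl, cutoff_eq hR0 k this]
  have hsub : {x | ∃ ε : ℝ, 0 < ε ∧ T < ‖derivPotential (cutoff ε k) e ν x‖ₑ} ⊆
      {x | ∃ ε : ℝ, 0 < ε ∧ t < ‖derivPotential (cutoff ε l) e ν x‖ₑ} := by
    rintro x ⟨ε, hε, hx⟩
    refine ⟨ε, hε, ?_⟩
    by_contra hcon
    refine hx.not_ge ?_
    set q := cutoff ε (cutoff R k) with hq
    have hqK : HasKernelBound (c * (c * A)) q := hc _ _ hRk (by positivity) ε
    have hq2 : ContDiff ℝ 2 q := contDiff_cutoff hε hRk.1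
    have hq0 : ∀ x ∈ ball (0 : E) R, q x = 0 := fun x hx => by
      have : cutoff R k x = 0 := cutoff_eq_zero hR0 k (by simpa using (mem_ball.1 hx).le)
      rw [hq, cutoff, this, mul_zero, sub_zero]
    have hqM := hqK.norm_fderiv_le_of_eq_zero hR0 hq0
    have hl2 : ContDiff ℝ 2 (cutoff ε l) := contDiff_cutoff hε hlK.1
    have hlM := (hc _ _ hlK (by positivity) ε).norm_fderiv_le_of_eq_zero hε fun x hx =>
      cutoff_eq_zero hε l (by simpa using (mem_ball.1 hx).le)
    have hsplit : cutoff ε k = fun x => cutoff ε l x + q x := by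
      ext x; simp only [hq, cutoff, hl]; ring
    have h1 : derivPotential (cutoff ε k) e ν x =
        derivPotential (cutoff ε l) e ν x + derivPotential q e ν x := by
      rw [derivPotential, derivPotential, derivPotential,
        ← integral_add (integrable_fderiv_sub hl2 hlM e ν x) (integrable_fderiv_sub hq2 hqM e ν x)]
      refine integral_congr_ae (Eventually.of_forall fun y => ?_)
      simp only
      rw [hsplit, fderiv_fun_add (hl2.differentiable (by norm_num) _)
        (hq2.differentiable (by norm_num) _)]
      rfl
    have h2 : ‖derivPotential q e ν x‖ₑ ≤ t := by
      rw [← ofReal_norm]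
      refine ENNReal.ofReal_le_of_le_toReal ?_
      have := norm_integral_le_of_norm_le_const (μ := ν) (f := fun y => fderiv ℝ q (x - y) e)
        (C := c * (c * A) / R ^ finrank ℝ E) (Eventually.of_forall fun y =>
          ((fderiv ℝ q (x - y)).le_opNorm e).trans
            ((mul_le_of_le_one_right (norm_nonneg _) he).trans (hqM _)))
      refine this.trans (le_trans (le_of_eq ?_) haR)
      rw [ha, measureReal_def]; ring
    rw [h1, hTt, ENNReal.coe_add]
    exact (enorm_add_le _ _).trans (add_le_add (not_lt.1 hcon) h2)
  calc (T : ℝ≥0∞) * _ ≤ T * volume {x | ∃ ε : ℝ, 0 < ε ∧ t < ‖derivPotential (cutoff ε l) e ν x‖ₑ} := by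
        gcongr
    _ = 2 * (t * volume {x | ∃ ε : ℝ, 0 < ε ∧ t < ‖derivPotential (cutoff ε l) e ν x‖ₑ}) := by
        rw [hTt]; push_cast; ring
    _ ≤ 2 * (C * ν univ) := mul_le_mul' le_rfl (hC l hlK hls e he ν t)
    _ = _ := by push_cast; ring

end WeakType


/-! ### Integrals against a signed measure via its Jordan decomposition -/

section SignedIntegral

variable {X G : Type*} [MeasurableSpace X] [NormedAddCommGroup G] [NormedSpace ℝ G]

lemma posPart_le_variation (μ : SignedMeasure X) : μ.toJordanDecomposition.posPart ≤ μ.variation := by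
  rw [← SignedMeasure.totalVariation_eq_variation]
  exact Measure.le_add_right le_rfl

lemma negPart_le_variation (μ : SignedMeasure X) : μ.toJordanDecomposition.negPart ≤ μ.variation := by
  rw [← SignedMeasure.totalVariation_eq_variation]
  exact Measure.le_add_left le_rfl

instance isFiniteMeasure_signedMeasure_variation (μ : SignedMeasure X) :
    IsFiniteMeasure μ.variation := by
  rw [← SignedMeasure.totalVariation_eq_variation]
  infer_instance

lemma signedIntegral_eq_sub (μ : SignedMeasure X) {f : X → G} (hf : Integrable f μ.variation) :
    ∫ᵛ x, f x ∂<•μ = ∫ x, f x ∂μ.toJordanDecomposition.posPart -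
      ∫ x, f x ∂μ.toJordanDecomposition.negPart := by
  conv_lhs => rw [← μ.toSignedMeasure_toJordanDecomposition, JordanDecomposition.toSignedMeasure]
  rw [VectorMeasure.integral_sub_vectorMeasure, VectorMeasure.integral_toSignedMeasure,
    VectorMeasure.integral_toSignedMeasure]
  · rw [VectorMeasure.Integrable, Measure.variation_toSignedMeasure]
    exact hf.mono_measure (posPart_le_variation μ)
  · rw [VectorMeasure.Integrable, Measure.variation_toSignedMeasure]
    exact hf.mono_measure (negPart_le_variation μ)

lemma enorm_signedIntegral_le (μ : SignedMeasure X) (f : X → G) :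
    ‖∫ᵛ x, f x ∂<•μ‖ₑ ≤ ∫⁻ x, ‖f x‖ₑ ∂μ.variation := by
  refine VectorMeasure.enorm_integral_le_lintegral_enorm.trans ?_
  refine mul_le_of_le_one_left zero_le ?_
  rw [← ofReal_norm, ENNReal.ofReal_le_one, ContinuousLinearMap.opNorm_flip]
  exact ContinuousLinearMap.opNorm_lsmul_le

lemma continuousLinearMap_apply_signedIntegral [CompleteSpace G] (μ : SignedMeasure X) {f : X → G}
    (hf : Integrable f μ.variation) (L : G →L[ℝ] ℝ) :
    L (∫ᵛ x, f x ∂<•μ) = ∫ᵛ x, L (f x) ∂<•μ := by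
  rw [signedIntegral_eq_sub μ hf, signedIntegral_eq_sub μ (L.integrable_comp hf), map_sub,
    L.integral_comp_comm (hf.mono_measure (posPart_le_variation μ)),
    L.integral_comp_comm (hf.mono_measure (negPart_le_variation μ))]

end SignedIntegral

/-! ### Comparison of sharp and smooth truncations -/

section Sharp

lemma HasKernelBound.measurable {E : Type*} [NormedAddCommGroup E] [InnerProductSpace ℝ E]
    [MeasurableSpace E] [BorelSpace E] {A : ℝ} {K : E → ℝ} (hK : HasKernelBound A K) :
    Measurable K :=
  measurable_of_continuousOn_compl_singleton 0 hK.1.continuousOn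

lemma measurableSet_lt_norm {E : Type*} [NormedAddCommGroup E] [MeasurableSpace E] [BorelSpace E]
    (ε : ℝ) : MeasurableSet {x : E | ε < ‖x‖} :=
  measurableSet_lt measurable_const measurable_norm

variable {E : Type*} [NormedAddCommGroup E] [InnerProductSpace ℝ E] [FiniteDimensional ℝ E]

lemma norm_gradient (K : E → ℝ) (x : E) : ‖gradient K x‖ = ‖fderiv ℝ K x‖ := by
  rw [gradient, LinearIsometryEquiv.norm_map]

/-- The gradient of `K` truncated to the complement of the ball of radius `ε`. -/
noncomputable def truncatedGradient (K : E → ℝ) (ε : ℝ) : E → E :=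
  {x : E | ε < ‖x‖}.indicator (gradient K)

variable {A B : ℝ} {K : E → ℝ} [Nontrivial E]

lemma HasKernelBound.norm_truncatedGradient_le (hK : HasKernelBound A K) {ε : ℝ} (hε : 0 < ε)
    (x : E) : ‖truncatedGradient K ε x‖ ≤ A / ε ^ finrank ℝ E := by
  have hA := hK.nonneg
  by_cases hx : ε < ‖x‖
  · rw [truncatedGradient, indicator_of_mem (by exact hx), norm_gradient]
    refine (hK.norm_fderiv_le (norm_pos_iff.1 (hε.trans hx))).trans ?_
    gcongr
  · rw [truncatedGradient, indicator_of_notMem (by exact hx), norm_zero]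
    positivity

variable [MeasurableSpace E] [BorelSpace E]

lemma HasKernelBound.measurable_gradient (hK : HasKernelBound A K) : Measurable (gradient K) := by
  refine measurable_of_continuousOn_compl_singleton 0 fun x hx => ?_
  exact ((InnerProductSpace.toDual ℝ E).symm.continuous.continuousAt.comp
    (hK.differentiableAt_fderiv hx).continuousAt).continuousWithinAt

lemma HasKernelBound.measurable_truncatedGradient (hK : HasKernelBound A K) (ε : ℝ) :
    Measurable (truncatedGradient K ε) :=
  hK.measurable_gradient.indicator (measurableSet_lt_norm ε)

lemma HasKernelBound.integrable_truncatedGradient (hK : HasKernelBound A K) {ε : ℝ} (hε : 0 < ε)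
    (ν : Measure E) [IsFiniteMeasure ν] (x : E) :
    Integrable (fun y => truncatedGradient K ε (x - y)) ν :=
  (integrable_const (A / ε ^ finrank ℝ E)).mono'
    ((hK.measurable_truncatedGradient ε).comp (measurable_const.sub measurable_id)).aestronglyMeasurable
    (Eventually.of_forall fun _ => hK.norm_truncatedGradient_le hε _)

/-- The sharp and the smooth truncations differ by a multiple of the maximal function. -/
lemma enorm_integral_truncatedGradient_sub_le (hK : HasKernelBound A K) {ε : ℝ} (hε : 0 < ε)
    (hKε : HasKernelBound B (cutoff ε K)) {e : E} (he : ‖e‖ ≤ 1) {ν : Measure E} [IsFiniteMeasure ν]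
    {x : E} {D : ℝ} (hν : HasGrowthAt ν D x) :
    ‖∫ y, inner ℝ (truncatedGradient K ε (x - y)) e ∂ν - derivPotential (cutoff ε K) e ν x‖ₑ ≤
      ENNReal.ofReal (3 ^ finrank ℝ E * (A + B) * D) := by
  have hA := hK.nonneg
  have hB := hKε.nonneg
  have h2 := contDiff_cutoff hε hK.1
  have hM := hKε.norm_fderiv_le_of_eq_zero hε fun x hx =>
    cutoff_eq_zero hε K (by simpa using (mem_ball.1 hx).le)
  rw [derivPotential, ← integral_sub ((hK.integrable_truncatedGradient hε ν x).inner_const e)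
    (integrable_fderiv_sub h2 hM e ν x)]
  refine (enorm_integral_le_lintegral_enorm _).trans ?_
  -- Both truncations equal ∇K beyond 2ε, so only the ball of radius 3ε matters. There they are at
  -- most A/ε^d and B/ε^d, and the growth of ν supplies the compensating ε^d.
  rw [lintegral_eq_setLIntegral_of_eq_zero (measurableSet_ball (x := x) (ε := 3 * ε))]
  · refine (setLIntegral_enorm_le_of_norm_le (a := A / ε ^ finrank ℝ E + B / ε ^ finrank ℝ E)
      measurableSet_ball (by positivity) (fun y _ => ?_) (hν _ (by positivity))).trans_eq ?_
    · refine (norm_sub_le _ _).trans (add_le_add ?_ ?_)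
      · exact (norm_inner_le_norm _ _).trans ((mul_le_of_le_one_right (norm_nonneg _) he).trans
          (hK.norm_truncatedGradient_le hε _))
      · exact (ContinuousLinearMap.le_opNorm _ _).trans
          ((mul_le_of_le_one_right (norm_nonneg _) he).trans (hM _))
    · congr 1
      rw [mul_pow]
      field_simp
  · intro y hy
    have h1 : 3 * ε ≤ ‖x - y‖ := by
      rw [← dist_eq_norm, dist_comm]
      exact not_lt.1 hy
    have hlt : 2 * ε < ‖x - y‖ := by linarith
    have h3 : cutoff ε K =ᶠ[𝓝 (x - y)] K := by
      filter_upwards [(isOpen_lt continuous_const continuous_norm).mem_nhds hlt] with w hw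
      exact cutoff_eq hε K (le_of_lt hw)
    have h4 : x - y ∈ {x : E | ε < ‖x‖} := show ε < ‖x - y‖ by linarith
    rw [h3.fderiv_eq, truncatedGradient, indicator_of_mem h4, inner_gradient_left, sub_self,
      enorm_zero]

end Sharp


/-! ### Signed measures: the maximal estimate and the expansion of the potential -/

section SignedKernel

lemma OrthonormalBasis.enorm_le_sum_enorm_inner {ι E : Type*} [Fintype ι] [NormedAddCommGroup E]
    [InnerProductSpace ℝ E] (b : OrthonormalBasis ι ℝ E) (x : E) :
    ‖x‖ₑ ≤ ∑ i, ‖inner ℝ x (b i)‖ₑ := by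
  conv_lhs => rw [← b.sum_repr' x]
  refine (enorm_sum_le _ _).trans (Finset.sum_le_sum fun i _ => ?_)
  rw [enorm_smul, ← ofReal_norm (b i), b.norm_eq_one, ENNReal.ofReal_one, mul_one, real_inner_comm]

variable {E : Type*} [NormedAddCommGroup E] [InnerProductSpace ℝ E] [FiniteDimensional ℝ E]
  [MeasurableSpace E] [BorelSpace E] [Nontrivial E] {A : ℝ} {K : E → ℝ}

lemma hasGrowthAt_of_notMem_maximalLevelSet {ν : Measure E} {t : ℝ≥0} {x : E}
    (hx : x ∉ maximalLevelSet ν t) : HasGrowthAt ν (t * (volume (ball (0 : E) 1)).toReal) x :=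
  fun r hr => by
    refine (measure_ball_le_of_notMem_maximalLevelSet hx hr).trans ?_
    rw [mul_assoc, ENNReal.ofReal_mul (p := (t : ℝ)) t.2, ENNReal.ofReal_coe_nnreal]
    exact mul_le_mul' le_rfl (hasGrowthAt_addHaar volume x r hr)

/-- The joint weak type `(1, 1)` estimate for the maximal function and the maximal singular
integral of a signed measure. -/
theorem exists_mul_volume_maximal_le (A : ℝ≥0) : ∃ Λ C : ℝ≥0, ∀ K : E → ℝ, HasKernelBound A K →
    ∀ (μ : SignedMeasure E) (t : ℝ≥0),
      t * volume (maximalLevelSet μ.variation t ∪ {x | ∃ ε : ℝ, 0 < ε ∧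
        (Λ * t : ℝ≥0) < ‖∫ᵛ y, truncatedGradient K ε (x - y) ∂<•μ‖ₑ}) ≤ C * μ.variation univ := by
  obtain ⟨c, hc1, hc⟩ := exists_hasKernelBound_cutoff E
  lift c to ℝ≥0 using (zero_le_one.trans hc1)
  obtain ⟨C₀, hC₀⟩ := exists_mul_volume_cutoff_le (E := E) A
  set d := finrank ℝ E with hd
  set v := (volume (ball (0 : E) 1)).toReal with hv
  have hv0 : 0 ≤ v := ENNReal.toReal_nonneg
  set a : ℝ≥0 := 3 ^ d * (A + c * A) * v.toNNReal with ha
  set b := stdOrthonormalBasis ℝ E with hb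
  -- There are d coordinates and two Jordan parts. Off the exceptional set each contributes at most
  -- t for the smooth truncation and at for its difference from the sharp one, which is controlled
  -- only off the level set of the maximal function; hence the joint estimate.
  refine ⟨d * (2 * (a + 1)), 4 ^ d + d * (2 * C₀), fun K hK μ t => ?_⟩
  rcases eq_or_ne t 0 with rfl | ht
  · simp
  have hcut : ∀ ε, HasKernelBound (c * A) (cutoff ε K) := fun ε => hc A K hK A.2 ε
  set P := μ.toJordanDecomposition.posPart with hP
  set Q := μ.toJordanDecomposition.negPart with hQ
  set S : Measure E → Fin d → Set E := fun ν i =>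
    {x | ∃ ε : ℝ, 0 < ε ∧ t < ‖derivPotential (cutoff ε K) (b i) ν x‖ₑ} with hS
  have hcomp : ∀ (ν : Measure E) [IsFiniteMeasure ν] (i : Fin d) (x : E), ν ≤ μ.variation →
      x ∉ maximalLevelSet μ.variation t → x ∉ S ν i → ∀ ε : ℝ, 0 < ε →
        ‖∫ y, inner ℝ (truncatedGradient K ε (x - y)) (b i) ∂ν‖ₑ ≤ (a + 1) * t := by
    intro ν _ i x hν hx hxS ε hε
    have h1 := enorm_integral_truncatedGradient_sub_le hK hε (hcut ε) (b.norm_eq_one i).le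
      ((hasGrowthAt_of_notMem_maximalLevelSet hx).mono_measure hν)
    have h2 : ‖derivPotential (cutoff ε K) (b i) ν x‖ₑ ≤ t := by
      by_contra hcon
      exact hxS ⟨ε, hε, not_le.1 hcon⟩
    have h3 : ENNReal.ofReal (3 ^ finrank ℝ E * (A + c * A) *
        (t * (volume (ball (0 : E) 1)).toReal)) = (a * t : ℝ≥0) := by
      rw [← ENNReal.ofReal_coe_nnreal, ha]
      push_cast
      rw [Real.coe_toNNReal _ hv0]
      congr 1
      ring
    rw [h3] at h1
    rw [← sub_add_cancel (∫ y, inner ℝ (truncatedGradient K ε (x - y)) (b i) ∂ν)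
      (derivPotential (cutoff ε K) (b i) ν x)]
    refine (enorm_add_le _ _).trans ((add_le_add h1 h2).trans_eq ?_)
    push_cast
    ring
  have hsub : maximalLevelSet μ.variation t ∪ {x | ∃ ε : ℝ, 0 < ε ∧
      ((d * (2 * (a + 1)) * t : ℝ≥0) : ℝ≥0∞) < ‖∫ᵛ y, truncatedGradient K ε (x - y) ∂<•μ‖ₑ} ⊆
        maximalLevelSet μ.variation t ∪ ⋃ i : Fin d, S P i ∪ S Q i := by
    refine union_subset subset_union_left ?_
    rintro x ⟨ε, hε, hx⟩
    by_contra hcon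
    simp only [mem_union, mem_iUnion, not_or, not_exists] at hcon
    obtain ⟨hxM, hxS⟩ := hcon
    refine hx.not_ge ?_
    have hint := hK.integrable_truncatedGradient hε μ.variation x
    refine (b.enorm_le_sum_enorm_inner _).trans ?_
    have hi : ∀ i, ‖inner ℝ (∫ᵛ y, truncatedGradient K ε (x - y) ∂<•μ) (b i)‖ₑ ≤
        2 * ((a + 1) * t) := by
      intro i
      have h1 := continuousLinearMap_apply_signedIntegral μ hint (innerSL ℝ (b i))
      simp only [innerSL_apply_apply] at h1
      rw [real_inner_comm, h1, signedIntegral_eq_sub μ (hint.const_inner (b i))]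
      simp only [real_inner_comm _ (b i)]
      rw [two_mul]
      refine enorm_sub_le.trans (add_le_add ?_ ?_)
      · simpa only [real_inner_comm] using
          hcomp P i x (posPart_le_variation μ) hxM (hxS i).1 ε hε
      · simpa only [real_inner_comm] using
          hcomp Q i x (negPart_le_variation μ) hxM (hxS i).2 ε hε
    refine (Finset.sum_le_sum fun i _ => hi i).trans_eq ?_
    rw [Finset.sum_const, Finset.card_univ, Fintype.card_fin, nsmul_eq_mul]
    push_cast
    ring
  have hSν : ∀ (ν : Measure E) [IsFiniteMeasure ν] (i : Fin d), ν ≤ μ.variation →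
      t * volume (S ν i) ≤ C₀ * μ.variation univ := fun ν _ i hν =>
    (hC₀ K hK (b i) (b.norm_eq_one i).le ν t).trans (mul_le_mul' le_rfl (hν univ))
  have hsum : volume (⋃ i : Fin d, S P i ∪ S Q i) ≤ ∑ i : Fin d, (volume (S P i) + volume (S Q i)) :=
    (measure_iUnion_fintype_le _ _).trans (Finset.sum_le_sum fun i _ => measure_union_le _ _)
  calc _ ≤ t * (volume (maximalLevelSet μ.variation t) +
        ∑ i : Fin d, (volume (S P i) + volume (S Q i))) :=
        mul_le_mul' le_rfl ((measure_mono hsub).trans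
          ((measure_union_le _ _).trans (add_le_add le_rfl hsum)))
    _ = t * volume (maximalLevelSet μ.variation t) +
        ∑ i : Fin d, (t * volume (S P i) + t * volume (S Q i)) := by
        rw [mul_add, Finset.mul_sum]
        simp only [mul_add]
    _ ≤ 4 ^ d * μ.variation univ +
        ∑ i : Fin d, (C₀ * μ.variation univ + C₀ * μ.variation univ) := by
        refine add_le_add (mul_volume_maximalLevelSet_le _ (by exact_mod_cast ht))
          (Finset.sum_le_sum fun i _ => add_le_add ?_ ?_)
        · exact hSν P i (posPart_le_variation μ)
        · exact hSν Q i (negPart_le_variation μ)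
    _ = _ := by
        rw [Finset.sum_const, Finset.card_univ, Fintype.card_fin, nsmul_eq_mul]
        push_cast
        ring

/-- The potential of a finite measure is absolutely convergent at points of finite growth. -/
lemma HasGrowthAt.integrable_kernel {ν : Measure E} [IsFiniteMeasure ν] {D : ℝ} {x : E}
    (h : HasGrowthAt ν D x) (hD : 0 ≤ D) (hK : HasKernelBound A K) :
    Integrable (fun w => K (x - w)) ν := by
  have hA := hK.nonneg
  refine ⟨(hK.measurable.comp (measurable_const.sub measurable_id)).aestronglyMeasurable, ?_⟩
  rw [HasFiniteIntegral, ← lintegral_add_compl _ (measurableSet_ball (x := x) (ε := 1))]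
  refine ENNReal.add_lt_top.2 ⟨(h.lintegral_ball_le hD hA one_pos fun w _ hw => ?_).trans_lt
    ENNReal.ofReal_lt_top, ?_⟩
  · rw [norm_sub_rev]
    exact hK.norm_le (sub_ne_zero.2 hw.symm)
  · refine (setLIntegral_enorm_le_of_norm_le (a := A) (b := (ν univ).toReal)
      measurableSet_ball.compl hA (fun w hw => ?_) ?_).trans_lt ENNReal.ofReal_lt_top
    · have h1 : 1 ≤ ‖x - w‖ := by
        rw [← dist_eq_norm, dist_comm]
        exact not_lt.1 hw
      refine (hK.norm_le (norm_pos_iff.1 (by linarith))).trans ?_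
      exact div_le_self hA (one_le_pow₀ h1)
    · rw [ENNReal.ofReal_toReal (measure_ne_top _ _)]
      exact measure_mono (subset_univ _)

/-- The first order expansion of a potential: the difference quotient is controlled by a truncated
singular integral and the growth of the measure at both points. -/
theorem enorm_signedIntegral_kernel_sub_le (hK : HasKernelBound A K) (μ : SignedMeasure E) {x y : E}
    (hxy : x ≠ y) {Dx Dy : ℝ} (hDx : 0 ≤ Dx) (hDy : 0 ≤ Dy) (hx : HasGrowthAt μ.variation Dx x)
    (hy : HasGrowthAt μ.variation Dy y) :
    ‖(∫ᵛ w, K (x - w) ∂<•μ) - ∫ᵛ w, K (y - w) ∂<•μ‖ₑ ≤ ‖x - y‖ₑ *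
      (‖∫ᵛ w, truncatedGradient K (2 * ‖x - y‖) (x - w) ∂<•μ‖ₑ +
        ENNReal.ofReal (4 ^ finrank ℝ E * 5 * A * (Dx + Dy))) := by
  have hA := hK.nonneg
  set d := finrank ℝ E with hd
  set r := ‖x - y‖ with hr
  have hr0 : 0 < r := norm_pos_iff.2 (sub_ne_zero.2 hxy)
  set ν := μ.variation with hν
  have hix := hx.integrable_kernel hDx hK
  have hiy := hy.integrable_kernel hDy hK
  have hiG := hK.integrable_truncatedGradient (ε := 2 * r) (by positivity) ν x
  -- The linear Taylor term, kept only where |x - w| > 2r, the range in which the segment from x - w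
  -- to y - w stays away from the origin. Its integral is the truncated singular integral paired
  -- with x - y.
  set g : E → ℝ := fun w => inner ℝ (x - y) (truncatedGradient K (2 * r) (x - w)) with hg
  have hig : Integrable g ν := hiG.const_inner (x - y)
  set h : E → ℝ := fun w => K (x - w) - K (y - w) - g w with hh
  have hsplit : (∫ᵛ w, K (x - w) ∂<•μ) - ∫ᵛ w, K (y - w) ∂<•μ =
      ∫ᵛ w, h w ∂<•μ + inner ℝ (x - y) (∫ᵛ w, truncatedGradient K (2 * r) (x - w) ∂<•μ) := by
    have h1 := continuousLinearMap_apply_signedIntegral μ hiG (innerSL ℝ (x - y))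
    simp only [innerSL_apply_apply] at h1
    have h2 : ∫ᵛ w, h w ∂<•μ = ∫ᵛ w, (K (x - w) - K (y - w)) ∂<•μ - ∫ᵛ w, g w ∂<•μ :=
      VectorMeasure.integral_fun_sub (hix.sub hiy) hig
    have h3 : ∫ᵛ w, (K (x - w) - K (y - w)) ∂<•μ =
        ∫ᵛ w, K (x - w) ∂<•μ - ∫ᵛ w, K (y - w) ∂<•μ := VectorMeasure.integral_fun_sub hix hiy
    rw [h1, h2, h3]
    exact (sub_add_cancel _ _).symm
  have hinner : ‖inner ℝ (x - y) (∫ᵛ w, truncatedGradient K (2 * r) (x - w) ∂<•μ)‖ₑ ≤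
      ‖x - y‖ₑ * ‖∫ᵛ w, truncatedGradient K (2 * r) (x - w) ∂<•μ‖ₑ := by
    rw [← ofReal_norm, ← ofReal_norm, ← ofReal_norm, ← ENNReal.ofReal_mul (norm_nonneg _)]
    exact ENNReal.ofReal_le_ofReal (norm_inner_le_norm _ _)
  have hnear : ∫⁻ w in closedBall x (2 * r), ‖h w‖ₑ ∂ν ≤
      ENNReal.ofReal (4 ^ d * A * Dx * (3 * r)) + ENNReal.ofReal (4 ^ d * A * Dy * (4 * r)) := by
    have hbx : ∫⁻ w in closedBall x (2 * r), ‖K (x - w)‖ₑ ∂ν ≤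
        ENNReal.ofReal (4 ^ d * A * Dx * (3 * r)) := by
      refine (lintegral_mono_set (closedBall_subset_ball (by linarith))).trans
        (hx.lintegral_ball_le hDx hA (by positivity) fun w _ hw => ?_)
      rw [norm_sub_rev]
      exact hK.norm_le (sub_ne_zero.2 hw.symm)
    have hby : ∫⁻ w in closedBall x (2 * r), ‖K (y - w)‖ₑ ∂ν ≤
        ENNReal.ofReal (4 ^ d * A * Dy * (4 * r)) := by
      refine (lintegral_mono_set fun w hw => ?_).trans
        (hy.lintegral_ball_le hDy hA (by positivity) fun w _ hw => ?_)
      · have h1 : dist w x ≤ 2 * r := hw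
        have h2 : dist x y = r := dist_eq_norm x y
        rw [mem_ball]
        linarith [dist_triangle w x y]
      · rw [norm_sub_rev]
        exact hK.norm_le (sub_ne_zero.2 hw.symm)
    refine le_trans ?_ (add_le_add hbx hby)
    have hm : Measurable fun w => ‖K (x - w)‖ₑ :=
      (hK.measurable.comp (measurable_const.sub measurable_id)).enorm
    rw [← lintegral_add_left hm]
    refine setLIntegral_mono' measurableSet_closedBall fun w hw => ?_
    have h0 : g w = 0 := by
      have : x - w ∉ {z : E | 2 * r < ‖z‖} := by
        simp only [mem_ofPred_eq, not_lt]
        rw [← dist_eq_norm, dist_comm]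
        exact hw
      simp only [hg]
      rw [truncatedGradient, indicator_of_notMem this, inner_zero_right]
    simp only [hh]
    rw [h0, sub_zero]
    exact enorm_sub_le
  have hfar : ∫⁻ w in (closedBall x (2 * r))ᶜ, ‖h w‖ₑ ∂ν ≤
      ENNReal.ofReal (2 ^ (d + 1) * (2 ^ (d + 1) * A * r ^ 2) * Dx / (2 * r)) := by
    -- The tail estimate integrates over the complement of an open ball, but on the sphere |x - w| =
    -- 2r the linear term is truncated away and the Taylor bound does not apply to h. The indicator
    -- removes the sphere.
    set f : E → ℝ := (closedBall x (2 * r))ᶜ.indicator h with hf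
    have h1 : ∫⁻ w in (closedBall x (2 * r))ᶜ, ‖h w‖ₑ ∂ν ≤
        ∫⁻ w in (ball x (2 * r))ᶜ, ‖f w‖ₑ ∂ν := by
      have : ∫⁻ w in (closedBall x (2 * r))ᶜ, ‖h w‖ₑ ∂ν =
          ∫⁻ w in (closedBall x (2 * r))ᶜ, ‖f w‖ₑ ∂ν :=
        setLIntegral_congr_fun measurableSet_closedBall.compl fun w hw => by
          simp only [hf, indicator_of_mem hw]
      rw [this]
      exact lintegral_mono_set (compl_subset_compl.2 ball_subset_closedBall)
    refine h1.trans (hx.lintegral_compl_ball_le hDx (by positivity) (by positivity) fun w _ => ?_)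
    by_cases hw : w ∈ (closedBall x (2 * r))ᶜ
    · have hxw : 2 * r < ‖x - w‖ := by
        rw [← dist_eq_norm, dist_comm]
        exact not_le.1 hw
      have h2 := hK.norm_sub_sub_fderiv_le (u := x - w) (v := y - w)
        (norm_pos_iff.1 (by linarith)) (by
          rw [sub_sub_sub_cancel_right, norm_sub_rev]; linarith)
      rw [sub_sub_sub_cancel_right, norm_sub_rev y x] at h2
      have hmem : x - w ∈ {z : E | 2 * r < ‖z‖} := hxw
      have h3 : h w = -(K (y - w) - K (x - w) - fderiv ℝ K (x - w) (y - x)) := by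
        simp only [hh, hg]
        rw [truncatedGradient, indicator_of_mem hmem, real_inner_comm, inner_gradient_left,
          ← neg_sub y x, map_neg]
        ring
      rw [hf, indicator_of_mem hw, h3, norm_neg, norm_sub_rev w x]
      exact h2.trans (le_of_eq (by ring))
    · rw [hf, indicator_of_notMem hw, norm_zero]
      positivity
  have hh' : ‖∫ᵛ w, h w ∂<•μ‖ₑ ≤ ‖x - y‖ₑ * ENNReal.ofReal (4 ^ d * 5 * A * (Dx + Dy)) := by
    refine (enorm_signedIntegral_le μ h).trans ?_
    rw [← lintegral_add_compl _ (measurableSet_closedBall (x := x) (ε := 2 * r))]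
    refine (add_le_add hnear hfar).trans ?_
    rw [← ENNReal.ofReal_add (by positivity) (by positivity),
      ← ENNReal.ofReal_add (by positivity) (by positivity), ← ofReal_norm (x - y), ← hr,
      ← ENNReal.ofReal_mul hr0.le]
    refine ENNReal.ofReal_le_ofReal ?_
    have h4 : (4 : ℝ) ^ d = 2 ^ d * 2 ^ d := by rw [← mul_pow]; norm_num
    have h5 : 2 ^ (d + 1) * (2 ^ (d + 1) * A * r ^ 2) * Dx / (2 * r) = 4 ^ d * A * Dx * (2 * r) := by
      rw [h4, pow_succ]; field_simp
    -- The coefficient of Dx is 3 + 2 from the near and far parts, that of Dy is 4; both are at most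
    -- 5.
    rw [h5]
    have h6 : 0 ≤ 4 ^ d * A * Dy * r := by positivity
    linarith
  rw [hsplit, mul_add, add_comm (‖x - y‖ₑ * _)]
  exact (enorm_add_le _ _).trans (add_le_add hh' hinner)

end SignedKernel

/-! ### Measurability of the maximal singular integral -/

section Measurability

variable {E : Type*} [NormedAddCommGroup E] [InnerProductSpace ℝ E] [FiniteDimensional ℝ E]
  [MeasurableSpace E] [BorelSpace E] [Nontrivial E] {A : ℝ} {K : E → ℝ}

lemma HasKernelBound.measurable_signedIntegral_truncatedGradient (hK : HasKernelBound A K)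
    (μ : SignedMeasure E) {ε : ℝ} (hε : 0 < ε) :
    Measurable fun x => ∫ᵛ y, truncatedGradient K ε (x - y) ∂<•μ := by
  have h : ∀ (ν : Measure E) [IsFiniteMeasure ν],
      Measurable fun x => ∫ y, truncatedGradient K ε (x - y) ∂ν := fun ν _ => by
    have : StronglyMeasurable (Function.uncurry fun x y : E => truncatedGradient K ε (x - y)) :=
      ((hK.measurable_truncatedGradient ε).comp
        (measurable_fst.sub measurable_snd)).stronglyMeasurable
    exact this.integral_prod_right.measurable
  have heq : (fun x => ∫ᵛ y, truncatedGradient K ε (x - y) ∂<•μ) = fun x =>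
      ∫ y, truncatedGradient K ε (x - y) ∂μ.toJordanDecomposition.posPart -
        ∫ y, truncatedGradient K ε (x - y) ∂μ.toJordanDecomposition.negPart :=
    funext fun x => signedIntegral_eq_sub μ (hK.integrable_truncatedGradient hε μ.variation x)
  rw [heq]
  exact (h _).sub (h _)

/-- The condition ε < |z| is strict, so for each z the truncation is eventually constant as δ
decreases to ε; dominated convergence applies. This right-continuity reduces the supremum over ε to
rational values. -/
lemma HasKernelBound.tendsto_signedIntegral_truncatedGradient (hK : HasKernelBound A K)
    (μ : SignedMeasure E) {ε : ℝ} (hε : 0 < ε) (x : E) :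
    Tendsto (fun δ => ∫ᵛ y, truncatedGradient K δ (x - y) ∂<•μ) (𝓝[>] ε)
      (𝓝 (∫ᵛ y, truncatedGradient K ε (x - y) ∂<•μ)) := by
  have hA := hK.nonneg
  have h : ∀ (ν : Measure E) [IsFiniteMeasure ν],
      Tendsto (fun δ => ∫ y, truncatedGradient K δ (x - y) ∂ν) (𝓝[>] ε)
        (𝓝 (∫ y, truncatedGradient K ε (x - y) ∂ν)) := fun ν _ => by
    refine tendsto_integral_filter_of_dominated_convergence
      (fun _ => A / ε ^ finrank ℝ E) ?_ ?_ (integrable_const _) ?_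
    · exact Eventually.of_forall fun δ => ((hK.measurable_truncatedGradient δ).comp
        (measurable_const.sub measurable_id)).aestronglyMeasurable
    · filter_upwards [self_mem_nhdsWithin] with δ hδ
      have hδ : ε < δ := hδ
      refine Eventually.of_forall fun y =>
        (hK.norm_truncatedGradient_le (hε.trans hδ) _).trans ?_
      gcongr
    · refine Eventually.of_forall fun y => tendsto_const_nhds.congr' ?_
      by_cases hy : ε < ‖x - y‖
      · filter_upwards [mem_nhdsWithin_of_mem_nhds (Iio_mem_nhds hy)] with δ hδ
        have h1 : x - y ∈ {z : E | ε < ‖z‖} := hy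
        have h2 : x - y ∈ {z : E | δ < ‖z‖} := hδ
        rw [truncatedGradient, truncatedGradient, indicator_of_mem h1, indicator_of_mem h2]
      · filter_upwards [self_mem_nhdsWithin] with δ hδ
        have h1 : x - y ∉ {z : E | ε < ‖z‖} := hy
        have h2 : x - y ∉ {z : E | δ < ‖z‖} := fun h => hy (lt_trans (show ε < δ from hδ) h)
        rw [truncatedGradient, truncatedGradient, indicator_of_notMem h1, indicator_of_notMem h2]
  rw [signedIntegral_eq_sub μ (hK.integrable_truncatedGradient hε μ.variation x)]
  refine ((h _).sub (h _)).congr' ?_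
  filter_upwards [self_mem_nhdsWithin] with δ hδ
  exact (signedIntegral_eq_sub μ
    (hK.integrable_truncatedGradient (hε.trans hδ) μ.variation x)).symm

lemma HasKernelBound.measurable_iSup_truncatedGradient (hK : HasKernelBound A K)
    (μ : SignedMeasure E) :
    Measurable fun x => ⨆ (ε : ℝ) (_ : 0 < ε), ‖∫ᵛ y, truncatedGradient K ε (x - y) ∂<•μ‖ₑ := by
  have heq : (fun x => ⨆ (ε : ℝ) (_ : 0 < ε), ‖∫ᵛ y, truncatedGradient K ε (x - y) ∂<•μ‖ₑ) =
      fun x => ⨆ (q : ℚ) (_ : 0 < (q : ℝ)), ‖∫ᵛ y, truncatedGradient K q (x - y) ∂<•μ‖ₑ := by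
    ext x
    refine le_antisymm (iSup₂_le fun ε hε => le_of_forall_lt fun b hb => ?_)
      (iSup₂_le fun q hq => le_iSup₂ (f := fun (ε : ℝ) (_ : 0 < ε) =>
        ‖∫ᵛ y, truncatedGradient K ε (x - y) ∂<•μ‖ₑ) (q : ℝ) hq)
    have h1 := (hK.tendsto_signedIntegral_truncatedGradient μ hε x).enorm.eventually
      (lt_mem_nhds hb)
    obtain ⟨u, hu, hsub⟩ := mem_nhdsGT_iff_exists_Ioo_subset.1 h1
    obtain ⟨q, hq1, hq2⟩ := exists_rat_btwn (show ε < u from hu)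
    exact lt_of_lt_of_le (hsub ⟨hq1, hq2⟩) (le_iSup₂ (f := fun (q : ℚ) (_ : 0 < (q : ℝ)) =>
      ‖∫ᵛ y, truncatedGradient K q (x - y) ∂<•μ‖ₑ) q (hε.trans hq1))
  rw [heq]
  refine Measurable.iSup fun q => ?_
  by_cases hq : 0 < (q : ℝ)
  · simp only [hq, iSup_pos]
    exact (hK.measurable_signedIntegral_truncatedGradient μ hq).enorm
  · simp only [hq, not_false_eq_true, iSup_neg]
    exact measurable_const

end Measurability


/-! ### Translation to the stated operators on Euclidean space -/

section PotentialKernel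

variable {N : ℕ} {K : EuclideanSpace ℝ (Fin N) → ℝ}

lemma IsPotentialKernel.exists_hasKernelBound (hK : IsPotentialKernel K) :
    ∃ A : ℝ≥0, HasKernelBound A K := by
  obtain ⟨h, A, hA⟩ := hK
  refine ⟨A.toNNReal, h, fun j hj x hx => (hA j hj x hx).trans ?_⟩
  rw [finrank_euclideanSpace_fin]
  gcongr
  exact Real.le_coe_toNNReal A

lemma lt_maximalFunction_iff {μ : SignedMeasure (EuclideanSpace ℝ (Fin N))} {t : ℝ≥0∞}
    {x : EuclideanSpace ℝ (Fin N)} :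
    t < maximalFunction μ x ↔ x ∈ maximalLevelSet μ.variation t := by
  simp only [maximalFunction, lt_iSup_iff, maximalLevelSet, mem_ofPred_eq, exists_prop]
  refine exists_congr fun r => and_congr_right fun hr => ?_
  exact ENNReal.lt_div_iff_mul_lt (Or.inl (measure_ball_pos volume x hr).ne')
    (Or.inl measure_ball_lt_top.ne)

lemma measurable_maximalFunction (μ : SignedMeasure (EuclideanSpace ℝ (Fin N))) :
    Measurable (maximalFunction μ) := by
  refine measurable_of_Ioi fun t => ?_
  have h : maximalFunction μ ⁻¹' Ioi t = maximalLevelSet μ.variation t :=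
    Set.ext fun x => lt_maximalFunction_iff
  rw [h]
  exact (isOpen_maximalLevelSet _ _).measurableSet

lemma hasGrowthAt_of_maximalFunction_ne_top [Nontrivial (EuclideanSpace ℝ (Fin N))]
    {μ : SignedMeasure (EuclideanSpace ℝ (Fin N))}
    {x : EuclideanSpace ℝ (Fin N)} (hx : maximalFunction μ x ≠ ∞) :
    HasGrowthAt μ.variation ((maximalFunction μ x).toReal *
      (volume (ball (0 : EuclideanSpace ℝ (Fin N)) 1)).toReal) x := by
  refine hasGrowthAt_of_notMem_maximalLevelSet (t := (maximalFunction μ x).toNNReal) ?_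
  rw [← lt_maximalFunction_iff, ENNReal.coe_toNNReal hx]
  exact lt_irrefl _

lemma truncatedSingularIntegral_eq (K : EuclideanSpace ℝ (Fin N) → ℝ)
    (μ : SignedMeasure (EuclideanSpace ℝ (Fin N))) (ε : ℝ) (x : EuclideanSpace ℝ (Fin N)) :
    truncatedSingularIntegral K μ ε x = ∫ᵛ y, truncatedGradient K ε (x - y) ∂<•μ := by
  have hs : MeasurableSet {y : EuclideanSpace ℝ (Fin N) | ε < ‖x - y‖} :=
    measurableSet_lt measurable_const (measurable_const.sub measurable_id).norm
  rw [truncatedSingularIntegral, ← VectorMeasure.integral_indicator hs]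
  rfl

lemma maximalSingularIntegral_eq (K : EuclideanSpace ℝ (Fin N) → ℝ)
    (μ : SignedMeasure (EuclideanSpace ℝ (Fin N))) (x : EuclideanSpace ℝ (Fin N)) :
    maximalSingularIntegral K μ x =
      ⨆ (ε : ℝ) (_ : 0 < ε), ‖∫ᵛ y, truncatedGradient K ε (x - y) ∂<•μ‖ₑ := by
  simp only [maximalSingularIntegral, truncatedSingularIntegral_eq]

lemma measure_eq_zero_of_forall_mul_le {α : Type*} [MeasurableSpace α] {ν : Measure α} {s : Set α}
    {B : ℝ≥0∞} (hB : B ≠ ∞) (h : ∀ t : ℝ≥0, 0 < t → t * ν s ≤ B) : ν s = 0 := by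
  by_contra hs
  obtain ⟨n, hn⟩ := ENNReal.exists_nat_mul_gt hs hB
  rcases n.eq_zero_or_pos with rfl | hn0
  · simp at hn
  · have := h n (by exact_mod_cast hn0)
    rw [ENNReal.coe_natCast] at this
    exact hn.not_ge this

lemma mul_volume_le_weakL1Norm (I : EuclideanSpace ℝ (Fin N) → ℝ≥0∞) {t : ℝ≥0} (ht : 0 < t) :
    t * volume {x | t < I x} ≤ weakL1Norm I :=
  le_iSup₂ (f := fun (t : ℝ≥0) (_ : 0 < t) => (t : ℝ≥0∞) * volume {x | (t : ℝ≥0∞) < I x}) t ht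

/-- The set where I is infinite lies in every superlevel set, so t times its volume stays bounded as
t grows. It serves as the null set in the theorem. -/
lemma volume_eq_top_of_weakL1Norm_ne_top {I : EuclideanSpace ℝ (Fin N) → ℝ≥0∞}
    (hI : weakL1Norm I ≠ ∞) : volume {x | I x = ∞} = 0 :=
  measure_eq_zero_of_forall_mul_le hI fun t ht => le_trans
    (mul_le_mul' le_rfl (measure_mono fun x (hx : I x = ∞) => by
      rw [mem_ofPred_eq, hx]; exact ENNReal.coe_lt_top))
    (mul_volume_le_weakL1Norm I ht)

lemma weakL1Norm_mono {I J : EuclideanSpace ℝ (Fin N) → ℝ≥0∞} (h : ∀ x, I x ≤ J x) :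
    weakL1Norm I ≤ weakL1Norm J :=
  iSup₂_mono fun _ _ => mul_le_mul' le_rfl (measure_mono fun x hx => lt_of_lt_of_le hx (h x))

/-- The weak type estimate for a multiple of the sum of the two maximal operators. -/
lemma exists_weakL1Norm_le [Nontrivial (EuclideanSpace ℝ (Fin N))] {A : ℝ≥0}
    (hK : HasKernelBound A K) {c : ℝ≥0} (hc : 0 < c) :
    ∃ C : ℝ≥0, 0 < C ∧ ∀ μ : SignedMeasure (EuclideanSpace ℝ (Fin N)),
      weakL1Norm (fun x => c * (maximalFunction μ x + maximalSingularIntegral K μ x)) ≤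
        C * μ.variation univ := by
  obtain ⟨Λ, C, h⟩ := exists_mul_volume_maximal_le (E := EuclideanSpace ℝ (Fin N)) A
  -- A level c(1 + Λ)τ is exceeded only where M(μ) > τ or T*(μ) > Λτ. The added 1 only makes the
  -- constant positive.
  refine ⟨c * (1 + Λ) * C + 1, by positivity, fun μ => iSup₂_le fun t ht => ?_⟩
  have hcΛ : c * (1 + Λ) ≠ 0 := by positivity
  obtain ⟨τ, rfl⟩ : ∃ τ, t = c * (1 + Λ) * τ := ⟨t / (c * (1 + Λ)), by field_simp⟩
  have hsub : {x | ((c * (1 + Λ) * τ : ℝ≥0) : ℝ≥0∞) <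
      c * (maximalFunction μ x + maximalSingularIntegral K μ x)} ⊆
      maximalLevelSet μ.variation τ ∪ {x | ∃ ε : ℝ, 0 < ε ∧
        (Λ * τ : ℝ≥0) < ‖∫ᵛ y, truncatedGradient K ε (x - y) ∂<•μ‖ₑ} := by
    intro x hx
    by_contra hcon
    simp only [mem_union, not_or, mem_ofPred_eq, not_exists, not_and, not_lt,
      ← lt_maximalFunction_iff] at hcon
    rw [mem_ofPred_eq] at hx
    refine hx.not_ge ?_
    have h2 : maximalSingularIntegral K μ x ≤ (Λ * τ : ℝ≥0) := by
      rw [maximalSingularIntegral_eq]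
      exact iSup₂_le hcon.2
    refine (mul_le_mul' le_rfl (add_le_add hcon.1 h2)).trans_eq ?_
    push_cast
    ring
  calc _ ≤ ((c * (1 + Λ) * τ : ℝ≥0) : ℝ≥0∞) * volume (maximalLevelSet μ.variation τ ∪
        {x | ∃ ε : ℝ, 0 < ε ∧
          (Λ * τ : ℝ≥0) < ‖∫ᵛ y, truncatedGradient K ε (x - y) ∂<•μ‖ₑ}) :=
        mul_le_mul' le_rfl (measure_mono hsub)
    _ ≤ ((c * (1 + Λ) : ℝ≥0) : ℝ≥0∞) * (C * μ.variation univ) := by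
        rw [ENNReal.coe_mul (c * (1 + Λ)) τ, mul_assoc]
        exact mul_le_mul' le_rfl (h K hK μ τ)
    _ = ((c * (1 + Λ) * C : ℝ≥0) : ℝ≥0∞) * μ.variation univ := by
        rw [ENNReal.coe_mul (c * (1 + Λ)) C, mul_assoc]
    _ ≤ _ := mul_le_mul' (by exact_mod_cast le_self_add) le_rfl

/-- Finite M(μ) at both points gives the growth required for the expansion of the potential. The
constant must absorb the coefficient 1 of T*(μ)(x) and the coefficient of M(μ). The expansion needs
T* at x only; T*(μ)(y) is added for symmetry. -/
lemma enorm_potential_sub_le [Nontrivial (EuclideanSpace ℝ (Fin N))] {A : ℝ≥0}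
    (hK : HasKernelBound A K) (μ : SignedMeasure (EuclideanSpace ℝ (Fin N)))
    {x y : EuclideanSpace ℝ (Fin N)} (hx : maximalFunction μ x ≠ ∞)
    (hy : maximalFunction μ y ≠ ∞) {c : ℝ≥0}
    (hc : 1 + 4 ^ N * 5 * A * (volume (ball (0 : EuclideanSpace ℝ (Fin N)) 1)).toNNReal ≤ c) :
    ‖potential K μ x - potential K μ y‖ₑ ≤
      ‖x - y‖ₑ * (c * (maximalFunction μ x + maximalSingularIntegral K μ x) +
        c * (maximalFunction μ y + maximalSingularIntegral K μ y)) := by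
  rcases eq_or_ne x y with rfl | hxy
  · simp
  have hT : ‖∫ᵛ w, truncatedGradient K (2 * ‖x - y‖) (x - w) ∂<•μ‖ₑ ≤
      maximalSingularIntegral K μ x := by
    rw [maximalSingularIntegral_eq]
    exact le_iSup₂ (f := fun (ε : ℝ) (_ : 0 < ε) =>
      ‖∫ᵛ w, truncatedGradient K ε (x - w) ∂<•μ‖ₑ) (2 * ‖x - y‖)
      (mul_pos two_pos (norm_pos_iff.2 (sub_ne_zero.2 hxy)))
  have h := enorm_signedIntegral_kernel_sub_le hK μ hxy (by positivity) (by positivity)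
    (hasGrowthAt_of_maximalFunction_ne_top hx) (hasGrowthAt_of_maximalFunction_ne_top hy)
  refine h.trans (mul_le_mul' le_rfl ?_)
  rw [finrank_euclideanSpace_fin]
  set B := 4 ^ N * 5 * A * (volume (ball (0 : EuclideanSpace ℝ (Fin N)) 1)).toNNReal with hB
  have hD : ENNReal.ofReal (4 ^ N * 5 * A * ((maximalFunction μ x).toReal *
      (volume (ball (0 : EuclideanSpace ℝ (Fin N)) 1)).toReal + (maximalFunction μ y).toReal *
      (volume (ball (0 : EuclideanSpace ℝ (Fin N)) 1)).toReal)) =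
      B * (maximalFunction μ x + maximalFunction μ y) := by
    have : 4 ^ N * 5 * A * ((maximalFunction μ x).toReal *
        (volume (ball (0 : EuclideanSpace ℝ (Fin N)) 1)).toReal + (maximalFunction μ y).toReal *
        (volume (ball (0 : EuclideanSpace ℝ (Fin N)) 1)).toReal) =
        ((B * ((maximalFunction μ x).toNNReal + (maximalFunction μ y).toNNReal) : ℝ≥0) : ℝ) := by
      rw [hB]
      push_cast
      simp only [ENNReal.toReal]
      ring
    rw [this, ENNReal.ofReal_coe_nnreal]
    push_cast
    rw [ENNReal.coe_toNNReal hx, ENNReal.coe_toNNReal hy]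
  rw [hD]
  have hc1 : (1 : ℝ≥0∞) ≤ c := by exact_mod_cast le_self_add.trans hc
  have hcB : (B : ℝ≥0∞) ≤ c := by exact_mod_cast le_add_self.trans hc
  calc _ ≤ c * maximalSingularIntegral K μ x + c * (maximalFunction μ x + maximalFunction μ y) :=
        add_le_add (hT.trans (le_mul_of_one_le_left' hc1)) (mul_le_mul' hcB le_rfl)
    _ ≤ c * maximalSingularIntegral K μ x + c * (maximalFunction μ x + maximalFunction μ y) +
        c * maximalSingularIntegral K μ y := le_self_add
    _ = _ := by ring

end PotentialKernel

end

/-! ### The theorem -/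

theorem theoremB (N : ℕ) (hN : 1 ≤ N) (K : EuclideanSpace ℝ (Fin N) → ℝ)
    (hK : IsPotentialKernel K) :
    ∃ C C' : ℝ≥0, 0 < C ∧ 0 < C' ∧
      ∀ μ : SignedMeasure (EuclideanSpace ℝ (Fin N)),
        -- the potential is given by an absolutely convergent integral almost everywhere
        (∀ᵐ x : EuclideanSpace ℝ (Fin N), μ.Integrable (fun w => K (x - w))) ∧
        -- existence of a non-negative weak `L¹` function
        (∃ I : EuclideanSpace ℝ (Fin N) → ℝ≥0, Measurable I ∧
          PointwiseLipschitz (potential K μ) (fun x => (I x : ℝ≥0∞)) ∧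
          weakL1Norm (fun x => (I x : ℝ≥0∞)) ≤ C * μ.variation Set.univ) ∧
        -- the explicit choice `C' (M(μ) + T*(μ))`
        (Measurable (fun x => C' * (maximalFunction μ x + maximalSingularIntegral K μ x)) ∧
          PointwiseLipschitz (potential K μ)
            (fun x => C' * (maximalFunction μ x + maximalSingularIntegral K μ x)) ∧
          weakL1Norm (fun x => C' * (maximalFunction μ x + maximalSingularIntegral K μ x)) ≤
            C * μ.variation Set.univ) := by
  have : Nonempty (Fin N) := ⟨⟨0, hN⟩⟩
  obtain ⟨A, hA⟩ := hK.exists_hasKernelBound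
  set c : ℝ≥0 :=
    1 + 4 ^ N * 5 * A * (volume (Metric.ball (0 : EuclideanSpace ℝ (Fin N)) 1)).toNNReal with hc
  have hc0 : 0 < c := by positivity
  obtain ⟨C, hC, hw⟩ := exists_weakL1Norm_le hA hc0
  refine ⟨C, c, hC, hc0, fun μ => ?_⟩
  set J : EuclideanSpace ℝ (Fin N) → ℝ≥0∞ :=
    fun x => c * (maximalFunction μ x + maximalSingularIntegral K μ x) with hJ
  have hJmeas : Measurable J := by
    have hT : Measurable (maximalSingularIntegral K μ) := by
      rw [funext (maximalSingularIntegral_eq K μ)]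
      exact hA.measurable_iSup_truncatedGradient μ
    exact ((measurable_maximalFunction μ).add hT).const_mul _
  -- Off this null set M(μ) is finite, which gives both absolute convergence and the pointwise
  -- inequality. The finite-valued I is J with its infinite values replaced by 0 there.
  have hnull : volume {x | J x = ∞} = 0 := volume_eq_top_of_weakL1Norm_ne_top
    ((hw μ).trans_lt (ENNReal.mul_lt_top ENNReal.coe_lt_top (measure_lt_top _ _))).ne
  have hM : ∀ x, J x ≠ ∞ → maximalFunction μ x ≠ ∞ := fun x hx h => hx (by
    simp only [hJ]
    rw [h, top_add, ENNReal.mul_top (by exact_mod_cast hc0.ne')])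
  have hlip : ∀ x, J x ≠ ∞ → ∀ y, J y ≠ ∞ →
      ‖potential K μ x - potential K μ y‖ₑ ≤ ‖x - y‖ₑ * (J x + J y) := fun x hx y hy =>
    enorm_potential_sub_le hA μ (hM x hx) (hM y hy) hc.ge
  refine ⟨?_, ⟨fun x => (J x).toNNReal, hJmeas.ennreal_toNNReal, ⟨_, hnull, ?_⟩, ?_⟩,
    hJmeas, ⟨_, hnull, hlip⟩, hw μ⟩
  · have hae : ∀ᵐ x ∂volume, J x ≠ ∞ := by
      rw [MeasureTheory.ae_iff]
      simpa only [not_not] using hnull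
    filter_upwards [hae] with x hx
    exact (hasGrowthAt_of_maximalFunction_ne_top (hM x hx)).integrable_kernel (by positivity) hA
  · intro x hx y hy
    simp only [ENNReal.coe_toNNReal hx, ENNReal.coe_toNNReal hy]
    exact hlip x hx y hy
  · exact (weakL1Norm_mono fun x => ENNReal.coe_toNNReal_le_self).trans (hw μ)
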